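/- Let $H_{La}=\frac12\left(-i\nabla-\frac{q^{\perp}}{2}\right)^2$, $(q_1,q_2)^\perp:=(-q_2,q_1)$, be the Landau Hamiltonian in $L^2(\mathbb{R}^2)$, i.e. the closure of this differential expression on the Schwartz space $\mathcal{S}(\mathbb{R}^2)$, and for $n\in\mathbb{N}_0=\{0,1,2,\dots\}$ let $P_n$ be the orthogonal projection onto its $n$-th Landau level, the eigenspace of $H_{La}$ for the eigenvalue $n+\frac12$. Let $g(q):=e^{-|q|^2/2}$ for $q\in\mathbb{R}^2$, and let $\mathcal{G}$ be the set of all functions $V:\mathbb{R}^2\to\mathbb{R}$ of the form $$V(q)=(g\ast\mu)(q)=\int_{\mathbb{R}^2}g(q-q')\,d\mu(q')$$ for some real-valued (signed) Borel measure $\mu$ on $\mathbb{R}^2$ of finite total variation. Write $\langle a\rangle:=\max(1,|a|)$. Proposition. For every $V\in\mathcal{G}$ there is a constant $d>0$ such that for all $n,m\in\mathbb{N}_0$, in the operator norm on $L^2(\mathbb{R}^2)$ and with $V$ acting as a multiplication operator, $$\Vert P_nVP_m\Vert\le\frac{d}{\langle n-m\rangle}.$$ -/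

import Mathlib

open MeasureTheory
open scoped SchwartzMap LineDeriv ENNReal

noncomputable section

namespace Landau

/-- The Euclidean plane `ℝ²`. -/
abbrev Plane : Type := EuclideanSpace ℝ (Fin 2)

/-- The Hilbert space `L²(ℝ²)` of complex-valued square-integrable functions (Lebesgue measure). -/
abbrev L2 : Type := Lp ℂ 2 (volume : Measure Plane)

/-! ### The Landau Hamiltonian -/

/-- `(q₁, q₂)^⊥ = (-q₂, q₁)`. -/
def perp (q : Plane) : Plane := !₂[-q 1, q 0]

/-- The `j`-th component of `-i∇ - q^⊥/2`, acting on Schwartz functions. -/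
def velocity (j : Fin 2) : 𝓢(Plane, ℂ) →L[ℂ] 𝓢(Plane, ℂ) :=
  (-Complex.I) • LineDeriv.lineDerivOpCLM ℂ 𝓢(Plane, ℂ) (EuclideanSpace.single j (1 : ℝ))
    - SchwartzMap.smulLeftCLM ℂ (fun q : Plane => ((perp q j / 2 : ℝ) : ℂ))

/-- The differential expression `½ (-i∇ - q^⊥/2)²`, acting on Schwartz functions. -/
def hamiltonianSchwartz : 𝓢(Plane, ℂ) →L[ℂ] 𝓢(Plane, ℂ) :=
  (1 / 2 : ℂ) • ∑ j : Fin 2, velocity j ∘L velocity j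

/-- The embedding of the Schwartz space into `L²(ℝ²)`. -/
def schwartzToL2 : 𝓢(Plane, ℂ) →ₗ[ℂ] L2 :=
  (SchwartzMap.toLpCLM ℂ ℂ 2 (volume : Measure Plane)).toLinearMap

lemma schwartzToL2_injective : Function.Injective schwartzToL2 :=
  SchwartzMap.injective_toLp 2 (volume : Measure Plane)

/-- `½ (-i∇ - q^⊥/2)²` as an unbounded operator in `L²(ℝ²)` with domain the Schwartz space. -/
def hamiltonianCore : L2 →ₗ.[ℂ] L2 where
  domain := LinearMap.range schwartzToL2
  toFun := schwartzToL2 ∘ₗ hamiltonianSchwartz.toLinearMap ∘ₗ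
    (LinearEquiv.ofInjective schwartzToL2 schwartzToL2_injective).symm.toLinearMap

/-- The Landau Hamiltonian `H_La`: the operator in `L²(ℝ²)` that acts as `½ (-i∇ - q^⊥/2)²` on the
Schwartz space and has the Schwartz space as a core. -/
def hamiltonian : L2 →ₗ.[ℂ] L2 := hamiltonianCore.closure

lemma temperateGrowth_perp (j : Fin 2) :
    (fun q : Plane => ((perp q j / 2 : ℝ) : ℂ)).HasTemperateGrowth := by
  let T : Plane →L[ℝ] ℂ := Complex.ofRealCLM ∘L
    ((1 / 2 : ℝ) • (if j = 0 then -(EuclideanSpace.proj 1 : Plane →L[ℝ] ℝ)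
      else (EuclideanSpace.proj 0 : Plane →L[ℝ] ℝ)))
  have hT : (fun q : Plane => ((perp q j / 2 : ℝ) : ℂ)) = T := by
    funext q
    fin_cases j <;> simp [T, perp] <;> ring
  rw [hT]
  exact T.hasTemperateGrowth

/-- `(velocity j f)(q) = -i ∂ⱼ f(q) - (q^⊥)ⱼ/2 · f(q)`. -/
lemma velocity_apply (j : Fin 2) (f : 𝓢(Plane, ℂ)) (q : Plane) :
    velocity j f q = -Complex.I * (∂_{EuclideanSpace.single j (1 : ℝ)} f) q
      - ((perp q j / 2 : ℝ) : ℂ) * f q := by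
  simp only [velocity, sub_apply, smul_apply, LineDeriv.lineDerivOpCLM_apply,
    SchwartzMap.smulLeftCLM_apply_apply (temperateGrowth_perp j), smul_eq_mul]

lemma integral_inner_velocity (j : Fin 2) (f g : 𝓢(Plane, ℂ)) :
    inner ℂ (schwartzToL2 (velocity j f)) (schwartzToL2 g)
      = inner ℂ (schwartzToL2 f) (schwartzToL2 (velocity j g)) := by
  let L : ℂ →L[ℝ] ℂ →L[ℝ] ℂ :=
    (ContinuousLinearMap.mul ℝ ℂ) ∘L (Complex.conjCLE : ℂ →L[ℝ] ℂ)
  have hL (a b : ℂ) : L a b = (starRingEnd ℂ) a * b := by simp [L]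
  have key := SchwartzMap.integral_bilinear_lineDerivOp_right_eq_neg_left f g L
    (EuclideanSpace.single j (1 : ℝ)) (μ := (volume : Measure Plane))
  simp only [hL] at key
  have hin (u v : 𝓢(Plane, ℂ)) : inner ℂ (schwartzToL2 u) (schwartzToL2 v)
      = ∫ q, (starRingEnd ℂ) (u q) * v q := by
    refine (SchwartzMap.inner_toL2_toL2_eq u v).trans ?_
    simp [mul_comm]
  set D := LineDeriv.lineDerivOpCLM ℂ 𝓢(Plane, ℂ) (EuclideanSpace.single j (1 : ℝ)) with hD
  set M := SchwartzMap.smulLeftCLM ℂ (fun q : Plane => ((perp q j / 2 : ℝ) : ℂ)) with hM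
  have h1 : inner ℂ (schwartzToL2 f) (schwartzToL2 (D g))
      = - inner ℂ (schwartzToL2 (D f)) (schwartzToL2 g) := by
    rw [hin, hin]; exact key
  have h2 : inner ℂ (schwartzToL2 f) (schwartzToL2 (M g))
      = inner ℂ (schwartzToL2 (M f)) (schwartzToL2 g) := by
    rw [hin, hin]
    congr 1
    funext q
    simp only [hM, SchwartzMap.smulLeftCLM_apply_apply (temperateGrowth_perp j), smul_eq_mul,
      map_mul, Complex.conj_ofReal]
    ring
  have hv (u : 𝓢(Plane, ℂ)) : velocity j u = (-Complex.I) • D u - M u := rfl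
  rw [hv, hv]
  simp only [map_sub, map_smul, inner_sub_left, inner_sub_right, inner_smul_left,
    inner_smul_right, h1, h2]
  simp

lemma schwartzToL2_mem_domain (f : 𝓢(Plane, ℂ)) : schwartzToL2 f ∈ hamiltonianCore.domain :=
  LinearMap.mem_range_self schwartzToL2 f

lemma hamiltonianCore_apply (f : 𝓢(Plane, ℂ)) :
    hamiltonianCore ⟨schwartzToL2 f, schwartzToL2_mem_domain f⟩
      = schwartzToL2 (hamiltonianSchwartz f) := by
  have : (LinearEquiv.ofInjective schwartzToL2 schwartzToL2_injective).symm
      ⟨schwartzToL2 f, LinearMap.mem_range_self schwartzToL2 f⟩ = f := by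
    rw [LinearEquiv.symm_apply_eq]
    rfl
  change schwartzToL2 (hamiltonianSchwartz
    ((LinearEquiv.ofInjective schwartzToL2 schwartzToL2_injective).symm
      ⟨schwartzToL2 f, LinearMap.mem_range_self schwartzToL2 f⟩)) = _
  rw [this]

lemma hamiltonianCore_symmetric : hamiltonianCore.IsFormalAdjoint hamiltonianCore := by
  rintro ⟨_, f, rfl⟩ ⟨_, g, rfl⟩
  change inner ℂ (hamiltonianCore ⟨schwartzToL2 f, schwartzToL2_mem_domain f⟩) (schwartzToL2 g)
    = inner ℂ (schwartzToL2 f) (hamiltonianCore ⟨schwartzToL2 g, schwartzToL2_mem_domain g⟩)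
  rw [hamiltonianCore_apply, hamiltonianCore_apply]
  simp only [hamiltonianSchwartz, FunLike.coe_smul, Pi.smul_apply, map_smul, Fin.sum_univ_two,
    FunLike.coe_add, Pi.add_apply, map_add, inner_smul_left, inner_smul_right, inner_add_left,
    inner_add_right, ContinuousLinearMap.comp_apply, integral_inner_velocity]
  congr 1
  simp [map_ofNat]

lemma hamiltonianCore_dense : Dense (hamiltonianCore.domain : Set L2) := by
  exact SchwartzMap.denseRange_toLpCLM (E := Plane) (F := ℂ) (p := 2)
    (μ := (volume : Measure Plane)) (by simp)

/-- The closure defining `H_La` is a genuine operator closure. -/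
lemma hamiltonianCore_isClosable : hamiltonianCore.IsClosable :=
  (LinearPMap.adjoint_isClosed hamiltonianCore_dense).isClosable.leIsClosable
    (hamiltonianCore_symmetric.le_adjoint hamiltonianCore_dense)

lemma hamiltonian_isClosed : hamiltonian.IsClosed :=
  hamiltonianCore_isClosable.closure_isClosed

/-! ### Landau levels -/

/-- The `n`-th Landau level: the eigenspace of `H_La` for the eigenvalue `n + 1/2`, that is,
the set of all `ψ` in the domain of `H_La` with `H_La ψ = (n + 1/2) ψ`. -/
def level (n : ℕ) : Submodule ℂ L2 where
  carrier := {ψ | ∃ h : ψ ∈ hamiltonian.domain, hamiltonian ⟨ψ, h⟩ = ((n : ℂ) + 1 / 2) • ψ}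
  zero_mem' := ⟨zero_mem _, by
    have : (⟨0, zero_mem _⟩ : hamiltonian.domain) = 0 := rfl
    rw [this, LinearPMap.map_zero, smul_zero]⟩
  add_mem' := by
    rintro a b ⟨ha, ha'⟩ ⟨hb, hb'⟩
    refine ⟨add_mem ha hb, ?_⟩
    have : (⟨a + b, add_mem ha hb⟩ : hamiltonian.domain) = ⟨a, ha⟩ + ⟨b, hb⟩ := rfl
    rw [this, LinearPMap.map_add, ha', hb', smul_add]
  smul_mem' := by
    rintro c a ⟨ha, ha'⟩
    refine ⟨Submodule.smul_mem _ c ha, ?_⟩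
    have : (⟨c • a, Submodule.smul_mem _ c ha⟩ : hamiltonian.domain) = c • ⟨a, ha⟩ := rfl
    rw [this, LinearPMap.map_smul, ha', smul_comm]

lemma isClosed_level (n : ℕ) : IsClosed (level n : Set L2) := by
  have : (level n : Set L2) =
      (fun ψ : L2 => (ψ, ((n : ℂ) + 1 / 2) • ψ)) ⁻¹' (hamiltonian.graph : Set (L2 × L2)) := by
    ext ψ
    simp only [Set.mem_preimage, SetLike.mem_coe, LinearPMap.mem_graph_iff, level]
    constructor
    · rintro ⟨h, h'⟩
      exact ⟨⟨ψ, h⟩, rfl, h'⟩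
    · rintro ⟨⟨y, hy⟩, rfl, h'⟩
      exact ⟨hy, h'⟩
  rw [this]
  exact IsClosed.preimage (by fun_prop) hamiltonian_isClosed

instance instCompleteSpaceLevel (n : ℕ) : CompleteSpace (level n) := (isClosed_level n).completeSpace_coe

/-- `P_n`, the orthogonal projection of `L²(ℝ²)` onto the `n`-th Landau level. -/
def levelProj (n : ℕ) : L2 →L[ℂ] L2 := (level n).starProjection

/-! ### Potentials -/

/-- The Gaussian `g(q) = exp(-|q|²/2)`. -/
def gauss (q : Plane) : ℝ := Real.exp (-‖q‖ ^ 2 / 2)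

/-- The convolution `(g ∗ μ)(q) = ∫ g(q - y) dμ(y)` with a finite signed Borel measure `μ`. -/
def gaussConv (μ : SignedMeasure Plane) (q : Plane) : ℝ := ∫ᵛ y, gauss (q - y) ∂•μ

/-- The class `𝒢` of all `V = g ∗ μ` with `μ` a finite signed Borel measure (a `SignedMeasure` is
real-valued, hence has finite total variation). -/
def gaussClass : Set (Plane → ℝ) := {V | ∃ μ : SignedMeasure Plane, V = gaussConv μ}

lemma isFiniteMeasure_variation (μ : SignedMeasure Plane) : IsFiniteMeasure μ.variation := by
  rw [← SignedMeasure.totalVariation_eq_variation]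
  unfold SignedMeasure.totalVariation
  infer_instance

lemma continuous_gauss : Continuous gauss := by
  unfold gauss
  fun_prop

lemma norm_gauss_le (q : Plane) : ‖gauss q‖ ≤ 1 := by
  rw [gauss, Real.norm_eq_abs, Real.abs_exp, Real.exp_le_one_iff]
  have := sq_nonneg ‖q‖
  linarith

/-- Potentials in `𝒢` are bounded and measurable. -/
lemma memLp_top_of_mem_gaussClass {V : Plane → ℝ} (hV : V ∈ gaussClass) :
    MemLp (fun q => (V q : ℂ)) ∞ (volume : Measure Plane) := by
  obtain ⟨μ, rfl⟩ := hV
  have := isFiniteMeasure_variation μ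
  have hcont : Continuous (gaussConv μ) := by
    apply VectorMeasure.continuous_of_dominated (bound := fun _ => 1)
    · intro q
      exact (continuous_gauss.comp (by fun_prop)).aestronglyMeasurable
    · exact fun q => .of_forall fun y => norm_gauss_le _
    · exact integrable_const _
    · exact .of_forall fun y => continuous_gauss.comp (by fun_prop)
  have hbound (q : Plane) := VectorMeasure.norm_integral_le_of_norm_le_const (μ := μ)
    (B := ContinuousLinearMap.lsmul ℝ ℝ) (.of_forall fun y => norm_gauss_le (q - y))
  refine memLp_top_of_bound (Complex.continuous_ofReal.comp hcont).aestronglyMeasurable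
    (1 * ‖ContinuousLinearMap.lsmul ℝ ℝ (E := ℝ)‖ * μ.variation.real Set.univ)
    (.of_forall fun q => ?_)
  rw [Complex.norm_real]
  exact hbound q

/-- The operator on `L²(ℝ²)` of multiplication by an essentially bounded function. -/
def mulOp (V : Plane → ℂ) (hV : MemLp V ∞ (volume : Measure Plane)) : L2 →L[ℂ] L2 :=
  (ContinuousLinearMap.mul ℂ ℂ).holderL volume ∞ 2 2 (hV.toLp V)

/-- `mulOp V` acts by `ψ ↦ V ψ`. -/
lemma mulOp_apply (V : Plane → ℂ) (hV : MemLp V ∞ (volume : Measure Plane)) (ψ : L2) :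
    mulOp V hV ψ =ᵐ[volume] fun q => V q * ψ q := by
  filter_upwards [(ContinuousLinearMap.mul ℂ ℂ).coeFn_holder (r := 2) (hV.toLp V) ψ,
    hV.coeFn_toLp] with q h1 h2
  rw [mulOp, ContinuousLinearMap.holderL_apply_apply, h1, ContinuousLinearMap.mul_apply', h2]

/-- `⟨a⟩ = max(1, |a|)`. -/
def bracket (a : ℝ) : ℝ := max 1 |a|

end Landau

end

open scoped Nat InnerProductSpace FourierTransform

/-! By Fubini, `⟪x, V y⟫` is the average over `w`, with respect to `μ`, of `⟪x, gaussOp w y⟫`. It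
therefore suffices to bound the blocks of multiplication by a single Gaussian centred at `w`,
uniformly in `w`; the total mass of `μ` then enters only as a factor.

For fixed `w`, `L²(ℝ²)` has an orthonormal basis indexed by `(n, k)`, where `n` is the Landau level
and `k` is the excitation of the guiding centre oscillator around `w`. The Gaussian is radial about
`w`, hence preserves angular momentum, and the entry between `(n, k)` and `(m, l)` vanishes unless
`m + k = l + n`. A block between two levels thus has at most one nonzero entry in each row and
column, and its norm is at most the supremum of the entries
(`HilbertBasis.norm_inner_map_le_of_entries`).

The Gaussian also exchanges the two oscillators: `A G = G B'` and `B G = G A'`. This moves every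
ladder operator to one side and evaluates the entries (`GaussianLadder.inner_state_G_state`). With
`N = l + n`, the normalised entry is `√(C(N,n) C(N,m)) / 2^N` times a ground state expectation of
modulus at most one. This is the geometric mean of two fair binomial probabilities, and `C(N,n)
C(N,m) (n - m)² ≤ 2 · 4^N` (`Nat.choose_mul_choose_mul_sq_sub_le`) gives the decay in `n - m`,
uniformly in `N`.

To apply this to the spectral definition of the levels, two facts are needed: the states are
complete (`Landau.orthogonal_span_basisVec`), and an eigenvector of level `n` is orthogonal to the
states of every other level (`Landau.inner_landauBasis_eq_zero_of_mem_level`). -/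

/-! ### Estimates for products of binomial coefficients -/

/-- The induction step reduces to `(2n + 1)(2n + 3) ≤ 4(n + 1)²`. The factor `2n + 1` records the
`n^(-1/2)` gain over the trivial bound `4^n`. -/
lemma Nat.centralBinom_sq_mul_le (n : ℕ) : n.centralBinom ^ 2 * (2 * n + 1) ≤ 16 ^ n := by
  induction n with
  | zero => simp
  | succ n ih =>
    have h := Nat.succ_mul_centralBinom_succ n
    refine le_of_mul_le_mul_left (a := (n + 1) ^ 2) ?_ (by positivity)
    calc (n + 1) ^ 2 * ((n + 1).centralBinom ^ 2 * (2 * (n + 1) + 1))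
        = ((n + 1) * (n + 1).centralBinom) ^ 2 * (2 * n + 3) := by ring
      _ = (n.centralBinom ^ 2 * (2 * n + 1)) * (4 * ((2 * n + 1) * (2 * n + 3))) := by
          rw [h]; ring
      _ ≤ 16 ^ n * (4 * (4 * (n + 1) ^ 2)) := by
          exact Nat.mul_le_mul ih (by nlinarith)
      _ = (n + 1) ^ 2 * 16 ^ (n + 1) := by ring

lemma Nat.choose_half_sq_mul_le (N : ℕ) : (N.choose (N / 2)) ^ 2 * (N + 1) ≤ 4 ^ N := by
  obtain ⟨n, rfl | rfl⟩ := N.even_or_odd'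
  · have := Nat.centralBinom_sq_mul_le n
    rw [Nat.centralBinom_eq_two_mul_choose] at this
    rw [Nat.mul_div_cancel_left n two_pos, pow_mul]
    exact this
  · have h1 := Nat.centralBinom_sq_mul_le (n + 1)
    have h2 : (n + 1).centralBinom = 2 * (2 * n + 1).choose n := by
      rw [Nat.centralBinom_eq_two_mul_choose, show 2 * (n + 1) = 2 * n + 1 + 1 by ring,
        Nat.choose_succ_succ, Nat.choose_symm_half]
      ring
    have h3 : (2 * n + 1) / 2 = n := by omega
    rw [h2] at h1
    rw [h3, pow_succ 4, pow_mul]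
    rw [pow_succ 16] at h1
    norm_num at h1 ⊢
    nlinarith [Nat.zero_le (((2 * n + 1).choose n) ^ 2)]

/-- The weighted binomial coefficients `(N choose j) (2N + (2j - N)²)` decrease to the right of
the middle. -/
lemma Nat.choose_mul_weight_succ_le {N j : ℕ} (hj : N / 2 ≤ j) :
    (N.choose (j + 1) : ℝ) * (2 * N + (2 * (j + 1 : ℕ) - N) ^ 2)
      ≤ N.choose j * (2 * N + (2 * j - N) ^ 2) := by
  rcases lt_or_ge j N with h | h
  swap
  · rw [Nat.choose_eq_zero_of_lt (by omega)]
    simp only [Nat.cast_zero, zero_mul]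
    positivity
  have h1 : (N.choose (j + 1) : ℝ) * (j + 1) = N.choose j * (N - j) := by
    have := Nat.choose_succ_right_eq N j
    have h2 : ((N - j : ℕ) : ℝ) = N - j := by push_cast [h.le]; ring
    rw [← h2]
    exact_mod_cast this
  have hs : (0 : ℝ) ≤ 2 * j - N + 1 := by
    have : N ≤ 2 * j + 1 := by omega
    have : (N : ℝ) ≤ 2 * j + 1 := by exact_mod_cast this
    linarith
  have key : ((N : ℝ) - j) * (2 * N + (2 * (j + 1) - N) ^ 2)
      ≤ (j + 1) * (2 * N + (2 * j - N) ^ 2) := by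
    -- With `s = 2j - N + 1`, the two sides of `key` differ by exactly `s(s² - 1)`: the summand `2N`
    -- in the weight is what cancels the terms linear in `N`. Integrality of `s` matters, since the
    -- product is negative for `0 < s < 1`.
    have hp : (0 : ℝ) ≤ (2 * j - N + 1) * ((2 * j - N + 1) ^ 2 - 1) := by
      rcases hs.eq_or_lt with h0 | h0
      · rw [← h0]; simp
      · apply mul_nonneg hs
        have : (0 : ℤ) < 2 * j - N + 1 := by exact_mod_cast h0
        have : (1 : ℤ) ≤ 2 * j - N + 1 := by omega
        have : (1 : ℝ) ≤ 2 * j - N + 1 := by exact_mod_cast this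
        nlinarith
    nlinarith
  have hc : (0 : ℝ) ≤ N.choose j := Nat.cast_nonneg _
  refine le_of_mul_le_mul_left (a := (j + 1 : ℝ)) ?_ (by positivity)
  push_cast
  calc (j + 1 : ℝ) * ((N.choose (j + 1) : ℝ) * (2 * N + (2 * (j + 1) - N) ^ 2))
      = ((N.choose (j + 1) : ℝ) * (j + 1)) * (2 * N + (2 * (j + 1) - N) ^ 2) := by ring
    _ = (N.choose j : ℝ) * (((N : ℝ) - j) * (2 * N + (2 * (j + 1) - N) ^ 2)) := by rw [h1]; ring
    _ ≤ (N.choose j : ℝ) * (((j : ℝ) + 1) * (2 * N + (2 * j - N) ^ 2)) := by gcongr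
    _ = _ := by ring

lemma Nat.choose_mul_weight_le {N j : ℕ} (hj : j ≤ N) :
    (N.choose j : ℝ) * (2 * N + (2 * j - N) ^ 2) ≤ N.choose (N / 2) * (2 * N + 1) := by
  have right (i : ℕ) (hi : N / 2 ≤ i) :
      (N.choose i : ℝ) * (2 * N + (2 * i - N) ^ 2) ≤ N.choose (N / 2) * (2 * N + 1) := by
    induction i, hi using Nat.le_induction with
    | base =>
      gcongr
      have h1 : (2 * (N / 2 : ℕ) : ℝ) ≤ N := by exact_mod_cast (by omega : 2 * (N / 2) ≤ N)
      have h2 : (N : ℝ) ≤ 2 * (N / 2 : ℕ) + 1 := by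
        exact_mod_cast (by omega : N ≤ 2 * (N / 2) + 1)
      nlinarith
    | succ i hi ih => exact (Nat.choose_mul_weight_succ_le hi).trans ih
  rcases le_total (N / 2) j with h | h
  · exact right j h
  -- The reflection `j ↦ N - j` preserves both the binomial coefficient and the weight.
  · have := right (N - j) (by omega)
    rw [Nat.choose_symm hj, Nat.cast_sub hj] at this
    convert this using 3
    ring

/-- The weighted bound is applied to both coefficients. With `a = 2n - N` and `b = 2m - N`, the
product of weights `(2N + a²)(2N + b²)` is at least `2N(a² + b²) ≥ N(a - b)² = 4N(n - m)²`, so one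
of the outcomes being far from the middle suffices. The constant comes from `(2N + 1)² ≤ 8N(N + 1)`
for `N ≥ 1`. -/
lemma Nat.choose_mul_choose_mul_sq_sub_le {N n m : ℕ} (hn : n ≤ N) (hm : m ≤ N) :
    (N.choose n : ℝ) * N.choose m * (n - m) ^ 2 ≤ 2 * 4 ^ N := by
  rcases N.eq_zero_or_pos with rfl | hN
  · obtain rfl : n = 0 := by omega
    obtain rfl : m = 0 := by omega
    simp
  have hN1 : (1 : ℝ) ≤ N := by exact_mod_cast hN
  have hc : (N.choose (N / 2) : ℝ) ^ 2 * (N + 1) ≤ 4 ^ N := by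
    exact_mod_cast Nat.choose_half_sq_mul_le N
  have h1 := Nat.choose_mul_weight_le hn
  have h2 := Nat.choose_mul_weight_le hm
  have hw : 4 * N * ((n : ℝ) - m) ^ 2
      ≤ (2 * N + (2 * n - N) ^ 2) * (2 * N + (2 * m - N) ^ 2) := by
    have : 0 ≤ ((2 * n - N : ℝ) ^ 2) * (2 * m - N) ^ 2 := by positivity
    nlinarith [mul_nonneg (zero_le_one.trans hN1) (sq_nonneg ((2 * n - N : ℝ) + (2 * m - N)))]
  refine le_of_mul_le_mul_left (a := (4 * N : ℝ)) ?_ (by positivity)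
  calc 4 * (N : ℝ) * ((N.choose n : ℝ) * (N.choose m : ℝ) * (n - m) ^ 2)
      = (N.choose n : ℝ) * (N.choose m : ℝ) * (4 * N * ((n : ℝ) - m) ^ 2) := by ring
    _ ≤ (N.choose n : ℝ) * N.choose m
        * ((2 * N + (2 * n - N) ^ 2) * (2 * N + (2 * m - N) ^ 2)) := by gcongr
    _ = ((N.choose n : ℝ) * (2 * N + (2 * n - N) ^ 2)) * ((N.choose m : ℝ) * (2 * N + (2 * m - N) ^ 2)) := by
        ring
    _ ≤ ((N.choose (N / 2) : ℝ) * (2 * N + 1)) * ((N.choose (N / 2) : ℝ) * (2 * N + 1)) := by gcongr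
    _ = (N.choose (N / 2) : ℝ) ^ 2 * (2 * N + 1) ^ 2 := by ring
    _ ≤ (N.choose (N / 2) : ℝ) ^ 2 * ((N + 1) * (8 * N)) := by
        gcongr
        nlinarith
    _ = ((N.choose (N / 2) : ℝ) ^ 2 * (N + 1)) * (8 * N) := by ring
    _ ≤ 4 ^ N * (8 * N) := by gcongr
    _ = 4 * N * (2 * 4 ^ N) := by ring

/-- Two binomial probabilities with `N` fair trials: their geometric mean is small when the two
outcomes are far apart. -/
lemma Landau.sqrt_choose_mul_choose_le {N n m : ℕ} (hn : n ≤ N) (hm : m ≤ N) :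
    √((N.choose n : ℝ) * N.choose m) / 2 ^ N ≤ 2 / Landau.bracket ((n : ℝ) - m) := by
  have hb : 0 < Landau.bracket ((n : ℝ) - m) := lt_of_lt_of_le one_pos (le_max_left _ _)
  rw [div_le_div_iff₀ (by positivity) hb]
  apply abs_le_of_sq_le_sq' _ (by positivity) |>.2
  rw [mul_pow, Real.sq_sqrt (by positivity), mul_pow, ← pow_mul, mul_comm N 2, pow_mul]
  norm_num
  rcases max_choice 1 |(n : ℝ) - m| with h | h <;> rw [Landau.bracket, h]
  · have h1 : (N.choose n : ℝ) ≤ 2 ^ N := by exact_mod_cast Nat.choose_le_two_pow N n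
    have h2 : (N.choose m : ℝ) ≤ 2 ^ N := by exact_mod_cast Nat.choose_le_two_pow N m
    have h3 : (4 : ℝ) ^ N = 2 ^ N * 2 ^ N := by rw [← mul_pow]; norm_num
    have : (N.choose n : ℝ) * N.choose m ≤ 2 ^ N * 2 ^ N := by gcongr
    nlinarith [show (0 : ℝ) < 4 ^ N by positivity]
  · rw [sq_abs]
    have := Nat.choose_mul_choose_mul_sq_sub_le hn hm
    nlinarith [show (0 : ℝ) < 4 ^ N by positivity]

/-! ### Matrix elements of the Gaussian from ladder algebra -/

/-- Two commuting pairs `(A, A')`, `(B, B')` of ladder operators on a space `S` with an inner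
product pulled back along `J`, with a common ground state, and an operator `G` which intertwines
them like the multiplication by a Gaussian. -/
structure GaussianLadder {S H : Type*} [AddCommGroup S] [Module ℂ S] [NormedAddCommGroup H]
    [InnerProductSpace ℂ H] (J : S →ₗ[ℂ] H) where
  /-- The annihilation operator of the first pair. -/
  A : S →ₗ[ℂ] S
  /-- The creation operator of the first pair. -/
  A' : S →ₗ[ℂ] S
  /-- The annihilation operator of the second pair. -/
  B : S →ₗ[ℂ] S
  /-- The creation operator of the second pair. -/
  B' : S →ₗ[ℂ] S
  /-- The intertwining operator. -/
  G : S →ₗ[ℂ] S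
  /-- The ground state. -/
  ground : S
  A_ground : A ground = 0
  B_ground : B ground = 0
  A_A' (x : S) : A (A' x) = A' (A x) + (2 : ℂ) • x
  B_B' (x : S) : B (B' x) = B' (B x) + (2 : ℂ) • x
  A_B' (x : S) : A (B' x) = B' (A x)
  B_A' (x : S) : B (A' x) = A' (B x)
  A'_B' (x : S) : A' (B' x) = B' (A' x)
  inner_A' (x y : S) : ⟪J (A' x), J y⟫_ℂ = ⟪J x, J (A y)⟫_ℂ
  inner_B' (x y : S) : ⟪J (B' x), J y⟫_ℂ = ⟪J x, J (B y)⟫_ℂ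
  -- The next four relations express that conjugating `∂ᵢ` by `exp (-|q - w|² / 2)` adds `-(qᵢ -
  -- wᵢ)`, which turns `A` into `B'` and `B` into `A'`, and turns `A'` into `2A' - B` and `B'` into
  -- `2B' - A`.
  A_G (x : S) : A (G x) = G (B' x)
  B_G (x : S) : B (G x) = G (A' x)
  G_A' (x : S) : (2 : ℂ) • G (A' x) = A' (G x) + G (B x)
  G_B' (x : S) : (2 : ℂ) • G (B' x) = B' (G x) + G (A x)

namespace GaussianLadder

variable {S H : Type*} [AddCommGroup S] [Module ℂ S] [NormedAddCommGroup H]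
  [InnerProductSpace ℂ H] {J : S →ₗ[ℂ] H} (L : GaussianLadder J)

/-- The excited state `A'ⁿ B'ᵏ ground`. -/
def state (n k : ℕ) : S := L.A'^[n] (L.B'^[k] L.ground)

lemma state_zero_zero : L.state 0 0 = L.ground := rfl

lemma A'_state (n k : ℕ) : L.A' (L.state n k) = L.state (n + 1) k :=
  (Function.iterate_succ_apply' _ _ _).symm

lemma B'_state (n k : ℕ) : L.B' (L.state n k) = L.state n (k + 1) := by
  induction n with
  | zero => exact (Function.iterate_succ_apply' L.B' _ _).symm
  | succ n ih => rw [← A'_state, ← A'_state, ← L.A'_B', ih]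

lemma A_state_zero (k : ℕ) : L.A (L.state 0 k) = 0 := by
  induction k with
  | zero => exact L.A_ground
  | succ k ih => rw [← B'_state, L.A_B', ih, map_zero]

lemma B_state_zero (n : ℕ) : L.B (L.state n 0) = 0 := by
  induction n with
  | zero => exact L.B_ground
  | succ n ih => rw [← A'_state, L.B_A', ih, map_zero]

lemma A_state_succ (n k : ℕ) : L.A (L.state (n + 1) k) = (2 * (n + 1) : ℂ) • L.state n k := by
  induction n with
  | zero => rw [← A'_state, L.A_A', A_state_zero, map_zero]; simp
  | succ n ih =>
    rw [← A'_state, L.A_A', ih, map_smul, A'_state, ← add_smul]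
    push_cast
    ring_nf

lemma B_state_succ (n k : ℕ) : L.B (L.state n (k + 1)) = (2 * (k + 1) : ℂ) • L.state n k := by
  induction k with
  | zero => rw [← B'_state, L.B_B', B_state_zero, map_zero]; simp
  | succ k ih =>
    rw [← B'_state, L.B_B', ih, map_smul, B'_state, ← add_smul]
    push_cast
    ring_nf

lemma inner_A (x y : S) : ⟪J (L.A x), J y⟫_ℂ = ⟪J x, J (L.A' y)⟫_ℂ := by
  rw [← inner_conj_symm, ← L.inner_A', inner_conj_symm]

lemma inner_B (x y : S) : ⟪J (L.B x), J y⟫_ℂ = ⟪J x, J (L.B' y)⟫_ℂ := by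
  rw [← inner_conj_symm, ← L.inner_B', inner_conj_symm]

lemma inner_state (n k m l : ℕ) : ⟪J (L.state n k), J (L.state m l)⟫_ℂ
    = if n = m ∧ k = l then 2 ^ (n + k) * n ! * k ! * ⟪J L.ground, J L.ground⟫_ℂ else 0 := by
  induction n generalizing m with
  | zero =>
    cases m with
    | succ m => rw [← A'_state, ← L.inner_A, A_state_zero, map_zero]; simp
    | zero =>
      induction k generalizing l with
      | zero =>
        cases l with
        | zero => simp [state_zero_zero]
        | succ l => rw [← B'_state, ← L.inner_B, B_state_zero, map_zero]; simp
      | succ k ih =>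
        cases l with
        | zero => rw [← B'_state, L.inner_B', B_state_zero, map_zero]; simp
        | succ l =>
          rw [← B'_state, L.inner_B', B_state_succ, map_smul, inner_smul_right, ih]
          by_cases h : k = l
          · simp [h, Nat.factorial_succ, pow_succ]
            ring
          · simp [h]
  | succ n ih =>
    cases m with
    | zero => rw [← A'_state, L.inner_A', A_state_zero, map_zero]; simp
    | succ m =>
      rw [← A'_state, L.inner_A', A_state_succ, map_smul, inner_smul_right, ih]
      by_cases h : n = m ∧ k = l
      · simp [h.1, h.2, Nat.factorial_succ, pow_succ, Nat.succ_add]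
        ring
      · simp [h]

/-- Pairing `G_A'` with the ground state kills the term `A' G`, because its adjoint `A` annihilates
the ground state. Hence a creation operator to the right of `G` can be traded for half an
annihilation operator of the other pair, which lowers `M` and `N` together and produces the factor
`N`. -/
lemma inner_ground_G_state (M N : ℕ) : ⟪J L.ground, J (L.G (L.state M N))⟫_ℂ
    = if M = N then N ! * ⟪J L.ground, J (L.G L.ground)⟫_ℂ else 0 := by
  have hA (x : S) : 2 * ⟪J L.ground, J (L.G (L.A' x))⟫_ℂ = ⟪J L.ground, J (L.G (L.B x))⟫_ℂ := by
    rw [← inner_smul_right, ← map_smul, L.G_A', map_add, inner_add_right, ← L.inner_A,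
      L.A_ground, map_zero, inner_zero_left, zero_add]
  have hB (x : S) : 2 * ⟪J L.ground, J (L.G (L.B' x))⟫_ℂ = ⟪J L.ground, J (L.G (L.A x))⟫_ℂ := by
    rw [← inner_smul_right, ← map_smul, L.G_B', map_add, inner_add_right, ← L.inner_B,
      L.B_ground, map_zero, inner_zero_left, zero_add]
  induction M generalizing N with
  | zero =>
    cases N with
    | zero => simp [state_zero_zero]
    | succ N =>
      have := hB (L.state 0 N)
      rw [A_state_zero, map_zero, map_zero, inner_zero_right, B'_state] at this
      simpa using this
  | succ M ih =>
    have := hA (L.state M N)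
    rw [A'_state] at this
    cases N with
    | zero =>
      rw [B_state_zero, map_zero, map_zero, inner_zero_right] at this
      simpa using this
    | succ N =>
      rw [B_state_succ, map_smul, map_smul, inner_smul_right, ih, mul_assoc] at this
      rw [mul_left_cancel₀ two_ne_zero this]
      by_cases h : M = N <;> simp [h, Nat.factorial_succ, mul_assoc]

/-- Each `A'` on the left passes through as `A G = G B'`, and each `B'` as `B G = G A'`. The left
state becomes the ground state, while the right one becomes the state `(m + k, l + n)`. -/
lemma inner_state_G_state (n k m l : ℕ) : ⟪J (L.state n k), J (L.G (L.state m l))⟫_ℂ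
    = if m + k = l + n then (l + n)! * ⟪J L.ground, J (L.G L.ground)⟫_ℂ else 0 := by
  rw [← inner_ground_G_state]
  induction n generalizing l with
  | zero =>
    induction k generalizing m with
    | zero => rfl
    | succ k ih =>
      rw [← B'_state, L.inner_B', L.B_G, A'_state, ih, Nat.succ_add m k]
      rfl
  | succ n ih =>
    rw [← A'_state, L.inner_A', L.A_G, B'_state, ih, Nat.succ_add l n]
    rfl

/-- The square of the norm of `L.state n k`, relative to that of the ground state. -/
noncomputable def normSq (n k : ℕ) : ℝ := 2 ^ (n + k) * n ! * k !

lemma normSq_pos (n k : ℕ) : 0 < normSq n k := by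
  unfold normSq
  positivity

lemma norm_sq_state (n k : ℕ) : ‖J (L.state n k)‖ ^ 2 = normSq n k * ‖J L.ground‖ ^ 2 := by
  have h := L.inner_state n k n k
  rw [inner_self_eq_norm_sq_to_K, inner_self_eq_norm_sq_to_K, if_pos ⟨rfl, rfl⟩] at h
  apply Complex.ofReal_injective
  rw [normSq]
  push_cast
  exact h

/-- The normalised excited states. -/
noncomputable def basisVec (p : ℕ × ℕ) : H := ((‖J (L.state p.1 p.2)‖⁻¹ : ℝ) : ℂ) • J (L.state p.1 p.2)

lemma norm_state (n k : ℕ) : ‖J (L.state n k)‖ = √(normSq n k) * ‖J L.ground‖ := by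
  rw [← Real.sqrt_sq (norm_nonneg (J (L.state n k))), norm_sq_state,
    Real.sqrt_mul (normSq_pos n k).le, Real.sqrt_sq (norm_nonneg _)]

lemma norm_state_ne_zero (h0 : J L.ground ≠ 0) (n k : ℕ) : ‖J (L.state n k)‖ ≠ 0 := by
  rw [norm_state]
  exact mul_ne_zero (Real.sqrt_ne_zero'.2 (normSq_pos n k)) (norm_ne_zero_iff.2 h0)

lemma orthonormal_basisVec (h0 : J L.ground ≠ 0) : Orthonormal ℂ L.basisVec := by
  constructor
  · rintro ⟨n, k⟩
    rw [basisVec, norm_smul, Complex.norm_real, norm_inv, norm_norm,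
      inv_mul_cancel₀ (L.norm_state_ne_zero h0 n k)]
  · rintro ⟨n, k⟩ ⟨m, l⟩ h
    rw [basisVec, basisVec, inner_smul_left, inner_smul_right, inner_state, if_neg]
    · simp
    · rintro ⟨rfl, rfl⟩
      exact h rfl

lemma inner_basisVec_of_ne (n k m l : ℕ) (T : H →L[ℂ] H) (hT : ∀ x, T (J x) = J (L.G x))
    (h : m + k ≠ l + n) : ⟪L.basisVec (n, k), T (L.basisVec (m, l))⟫_ℂ = 0 := by
  rw [basisVec, basisVec, map_smul, inner_smul_left, inner_smul_right, hT,
    inner_state_G_state, if_neg h]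
  simp

/-- With `N = l + n = m + k` one has `C(N,n) = N! / (l! n!)` and `C(N,m) = N! / (m! k!)`, and the
powers of two in the norms multiply to `2^(2N)`. -/
lemma sqrt_normSq_mul {n k m l : ℕ} (h : m + k = l + n) :
    ((l + n)! : ℝ) / (√(normSq n k) * √(normSq m l))
      = √(((l + n).choose n : ℝ) * (l + n).choose m) / 2 ^ (l + n) := by
  have h1 : ((l + n).choose n : ℝ) * (l ! * n !) = (l + n)! := by
    have := Nat.add_choose_mul_factorial_mul_factorial l n
    rw [mul_assoc] at this
    exact_mod_cast this
  have h2 : ((l + n).choose m : ℝ) * (m ! * k !) = (l + n)! := by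
    have := Nat.add_choose_mul_factorial_mul_factorial k m
    rw [add_comm k m, h, mul_assoc, mul_comm k !] at this
    exact_mod_cast this
  have h3 : normSq n k * normSq m l * ((l + n).choose n * (l + n).choose m)
      = (2 ^ (l + n) * (l + n)!) ^ 2 := by
    calc _ = (2 ^ (n + k) * 2 ^ (m + l)) * (((l + n).choose n : ℝ) * (l ! * n !))
          * ((l + n).choose m * (m ! * k !)) := by unfold normSq; ring
      _ = _ := by
        rw [h1, h2, ← pow_add, show n + k + (m + l) = 2 * (l + n) by omega, pow_mul']
        ring
  have h4 := Real.sqrt_pos.2 (normSq_pos n k)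
  have h5 := Real.sqrt_pos.2 (normSq_pos m l)
  rw [div_eq_div_iff (by positivity) (by positivity), ← Real.sqrt_mul (normSq_pos n k).le,
    mul_comm √_ √_, ← Real.sqrt_mul (mul_pos (normSq_pos n k) (normSq_pos m l)).le, h3,
    Real.sqrt_sq (by positivity), mul_comm]

lemma norm_inner_basisVec_le (h0 : J L.ground ≠ 0) (n k m l : ℕ) (T : H →L[ℂ] H)
    (hT : ∀ x, T (J x) = J (L.G x)) (hT1 : ‖T‖ ≤ 1) :
    ‖⟪L.basisVec (n, k), T (L.basisVec (m, l))⟫_ℂ‖ ≤ 2 / Landau.bracket ((n : ℝ) - m) := by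
  have hb : 0 < Landau.bracket ((n : ℝ) - m) := lt_of_lt_of_le one_pos (le_max_left _ _)
  by_cases h : m + k = l + n
  swap
  · rw [L.inner_basisVec_of_ne n k m l T hT h, norm_zero]
    positivity
  have hg : 0 < ‖J L.ground‖ := norm_pos_iff.2 h0
  have hG : ‖⟪J L.ground, J (L.G L.ground)⟫_ℂ‖ ≤ ‖J L.ground‖ * ‖J L.ground‖ := by
    rw [← hT]
    refine (norm_inner_le_norm _ _).trans ?_
    gcongr
    exact (T.le_of_opNorm_le hT1 _).trans_eq (one_mul _)
  rw [basisVec, basisVec, map_smul, inner_smul_left, inner_smul_right, hT,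
    inner_state_G_state, if_pos h, norm_mul, norm_mul, norm_mul, RCLike.norm_conj,
    Complex.norm_real, Complex.norm_real, norm_inv, norm_inv, norm_norm, norm_norm,
    Complex.norm_natCast, norm_state, norm_state]
  have h1 := Real.sqrt_pos.2 (normSq_pos n k)
  have h2 := Real.sqrt_pos.2 (normSq_pos m l)
  calc _ ≤ (√(normSq n k) * ‖J L.ground‖)⁻¹ * ((√(normSq m l) * ‖J L.ground‖)⁻¹
        * ((l + n)! * (‖J L.ground‖ * ‖J L.ground‖))) := by gcongr
    _ = ((l + n)! : ℝ) / (√(normSq n k) * √(normSq m l)) := by field_simp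
    _ ≤ _ := by
      rw [sqrt_normSq_mul h]
      exact Landau.sqrt_choose_mul_choose_le (by omega) (by omega)

end GaussianLadder

/-! ### Gaussians as Schwartz functions -/

namespace Landau

lemma exists_one_add_norm_pow_mul_exp_le {c : ℝ} (hc : 0 < c) (w : Plane) (m : ℕ) :
    ∃ K : ℝ, ∀ q : Plane, (1 + ‖q‖) ^ m * Real.exp (-(c * ‖q - w‖ ^ 2)) ≤ K := by
  refine ⟨(1 + ‖w‖) ^ m * (m ! * Real.exp (1 + 1 / (4 * c))), fun q => ?_⟩
  set t := ‖q - w‖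
  have h1 : 1 + ‖q‖ ≤ (1 + ‖w‖) * (1 + t) := by
    have : ‖q‖ ≤ ‖w‖ + t := norm_le_norm_add_norm_sub' q w
    nlinarith [norm_nonneg w, norm_nonneg (q - w), mul_nonneg (norm_nonneg w) (norm_nonneg (q - w))]
  have h2 : (1 + t) ^ m ≤ m ! * Real.exp (1 + t) := by
    have := Real.pow_div_factorial_le_exp (1 + t) (by positivity) m
    rwa [div_le_iff₀' (by positivity)] at this
  have h3 : t - c * t ^ 2 ≤ 1 / (4 * c) := by
    rw [le_div_iff₀ (by positivity)]
    nlinarith [sq_nonneg (2 * c * t - 1)]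
  calc (1 + ‖q‖) ^ m * Real.exp (-(c * t ^ 2))
      ≤ ((1 + ‖w‖) * (1 + t)) ^ m * Real.exp (-(c * t ^ 2)) := by gcongr
    _ = (1 + ‖w‖) ^ m * ((1 + t) ^ m * Real.exp (-(c * t ^ 2))) := by rw [mul_pow]; ring
    _ ≤ (1 + ‖w‖) ^ m * ((m ! * Real.exp (1 + t)) * Real.exp (-(c * t ^ 2))) := by gcongr
    _ = (1 + ‖w‖) ^ m * (m ! * Real.exp (1 + t - c * t ^ 2)) := by
      rw [mul_assoc (m ! : ℝ), ← Real.exp_add]; ring_nf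
    _ ≤ _ := by
      gcongr (1 + ‖w‖) ^ m * (m ! * Real.exp ?_)
      linarith

/-- The real derivatives are restrictions of the complex ones, and all complex derivatives of the
exponential coincide. -/
lemma norm_iteratedFDeriv_cexp (n : ℕ) (z : ℂ) :
    ‖iteratedFDeriv ℝ n Complex.exp z‖ = ‖Complex.exp z‖ := by
  rw [← (Complex.contDiff_exp (𝕜 := ℂ) (n := n)).contDiffAt.restrictScalars_iteratedFDeriv,
    Function.comp_apply, ContinuousMultilinearMap.norm_restrictScalars,
    norm_iteratedFDeriv_eq_norm_iteratedDeriv]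
  simp [iteratedDeriv_eq_iterate, Complex.iter_deriv_exp]

lemma contDiff_gaussianExponent (c : ℝ) (w v : Plane) {n : ℕ∞} : ContDiff ℝ n (fun q : Plane =>
    -((c * ‖q - w‖ ^ 2 : ℝ) : ℂ) + Complex.I * ((⟪v, q⟫_ℝ : ℝ) : ℂ)) := by
  have h1 : ContDiff ℝ n (fun q : Plane => ((c * ‖q - w‖ ^ 2 : ℝ) : ℂ)) :=
    Complex.ofRealCLM.contDiff.comp
      (contDiff_const.mul ((contDiff_id.sub contDiff_const).norm_sq ℝ))
  have h2 : ContDiff ℝ n (fun q : Plane => ((⟪v, q⟫_ℝ : ℝ) : ℂ)) :=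
    Complex.ofRealCLM.contDiff.comp (contDiff_const.inner ℝ contDiff_id)
  exact h1.neg.add (contDiff_const.mul h2)

/-- The Gaussian `q ↦ exp (-c |q - w|² + i ⟪v, q⟫)` as a Schwartz function. -/
noncomputable def gaussianSchwartz (c : ℝ) (hc : 0 < c) (w v : Plane) : 𝓢(Plane, ℂ) where
  toFun q := Complex.exp (-((c * ‖q - w‖ ^ 2 : ℝ) : ℂ) + Complex.I * ((⟪v, q⟫_ℝ : ℝ) : ℂ))
  smooth' := Complex.contDiff_exp.comp (contDiff_gaussianExponent c w v)
  decay' k n := by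
    set h : Plane → ℂ := fun q =>
      -((c * ‖q - w‖ ^ 2 : ℝ) : ℂ) + Complex.I * ((⟪v, q⟫_ℝ : ℝ) : ℂ) with hh
    have hsmooth : ContDiff ℝ n h := contDiff_gaussianExponent c w v
    have htemp : h.HasTemperateGrowth := by
      have h1 : (fun q : Plane => ‖q - w‖ ^ 2).HasTemperateGrowth :=
        (Function.hasTemperateGrowth_norm_sq Plane).comp
          (Function.HasTemperateGrowth.id'.sub (.const w))
      have h2 : (fun q : Plane => ((c * ‖q - w‖ ^ 2 : ℝ) : ℂ)).HasTemperateGrowth :=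
        Function.HasTemperateGrowth.comp Complex.ofRealCLM.hasTemperateGrowth ((Function.HasTemperateGrowth.const c).mul h1)
      have h3 : (fun q : Plane => ((⟪v, q⟫_ℝ : ℝ) : ℂ)).HasTemperateGrowth :=
        Function.HasTemperateGrowth.comp Complex.ofRealCLM.hasTemperateGrowth (Function.hasTemperateGrowth_inner_right v)
      exact h2.neg.add ((Function.HasTemperateGrowth.const Complex.I).mul h3)
    obtain ⟨l, C, hC, hbound⟩ := htemp.norm_iteratedFDeriv_le_uniform n
    obtain ⟨K, hK⟩ := exists_one_add_norm_pow_mul_exp_le hc w (k + l * n)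
    refine ⟨n ! * (C + 1) ^ n * K, fun q => ?_⟩
    have hnorm : ‖Complex.exp (h q)‖ = Real.exp (-(c * ‖q - w‖ ^ 2)) := by
      rw [Complex.norm_exp]
      simp [hh, -Complex.ofReal_mul, -Complex.ofReal_pow]
    -- Faà di Bruno requires the `i`-th derivative of the exponent to be at most `D ^ i`. A single
    -- polynomial bound `D` serves for all `i ≥ 1` once `D ≥ 1`, which is why `C` is enlarged to `C
    -- + 1`.
    have hD := norm_iteratedFDeriv_comp_le (g := Complex.exp) (f := h) (N := n)
      Complex.contDiff_exp hsmooth le_rfl q (C := ‖Complex.exp (h q)‖)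
      (D := (C + 1) * (1 + ‖q‖) ^ l)
      (fun i _ => (norm_iteratedFDeriv_cexp i _).le) (fun i hi hin => by
        have h1 : (1 : ℝ) ≤ (C + 1) * (1 + ‖q‖) ^ l :=
          one_le_mul_of_one_le_of_one_le (by linarith)
            (one_le_pow₀ (by linarith [norm_nonneg q]))
        refine (hbound i hin q).trans (le_trans ?_ (le_self_pow₀ h1 (by omega)))
        gcongr
        linarith)
    rw [hnorm] at hD
    calc ‖q‖ ^ k * ‖iteratedFDeriv ℝ n (Complex.exp ∘ h) q‖
        ≤ (1 + ‖q‖) ^ k * (n ! * Real.exp (-(c * ‖q - w‖ ^ 2))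
          * ((C + 1) * (1 + ‖q‖) ^ l) ^ n) := by
          gcongr
          linarith [norm_nonneg q]
      _ = n ! * (C + 1) ^ n * ((1 + ‖q‖) ^ (k + l * n) * Real.exp (-(c * ‖q - w‖ ^ 2))) := by
          rw [mul_pow, ← pow_mul, pow_add]; ring
      _ ≤ _ := by
          gcongr
          exact hK q

lemma gaussianSchwartz_apply (c : ℝ) (hc : 0 < c) (w v q : Plane) :
    gaussianSchwartz c hc w v q
      = Complex.exp (-((c * ‖q - w‖ ^ 2 : ℝ) : ℂ) + Complex.I * ((⟪v, q⟫_ℝ : ℝ) : ℂ)) := rfl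

lemma norm_gaussianSchwartz_apply (c : ℝ) (hc : 0 < c) (w v q : Plane) :
    ‖gaussianSchwartz c hc w v q‖ = Real.exp (-(c * ‖q - w‖ ^ 2)) := by
  rw [gaussianSchwartz_apply, Complex.norm_exp]
  simp [-Complex.ofReal_mul, -Complex.ofReal_pow]

/-! ### Velocities and guiding centre momenta: adjoints and commutators -/

/-- The partial derivative `∂ᵢ` on Schwartz functions. -/
noncomputable def partialDeriv (i : Fin 2) : 𝓢(Plane, ℂ) →L[ℂ] 𝓢(Plane, ℂ) :=
  LineDeriv.lineDerivOpCLM ℂ 𝓢(Plane, ℂ) (EuclideanSpace.single i (1 : ℝ))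

lemma hasTemperateGrowth_coord (i : Fin 2) :
    (fun q : Plane => ((q i : ℝ) : ℂ)).HasTemperateGrowth :=
  (Complex.ofRealCLM ∘L (EuclideanSpace.proj i : Plane →L[ℝ] ℝ)).hasTemperateGrowth

/-- The multiplication by the coordinate `qᵢ` on Schwartz functions. -/
noncomputable def coordMul (i : Fin 2) : 𝓢(Plane, ℂ) →L[ℂ] 𝓢(Plane, ℂ) :=
  SchwartzMap.smulLeftCLM ℂ (fun q : Plane => ((q i : ℝ) : ℂ))

lemma coordMul_apply (i : Fin 2) (f : 𝓢(Plane, ℂ)) (q : Plane) :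
    coordMul i f q = (q i : ℂ) * f q :=
  SchwartzMap.smulLeftCLM_apply_apply (hasTemperateGrowth_coord i) f q

lemma coordMul_comm (i j : Fin 2) (f : 𝓢(Plane, ℂ)) :
    coordMul i (coordMul j f) = coordMul j (coordMul i f) := by
  ext q
  simp only [coordMul_apply]
  ring

lemma partialDeriv_comm (i j : Fin 2) (f : 𝓢(Plane, ℂ)) :
    partialDeriv i (partialDeriv j f) = partialDeriv j (partialDeriv i f) := by
  ext q
  have hs : IsSymmSndFDerivAt ℝ f q :=
    (f.smooth 2).contDiffAt.isSymmSndFDerivAt (by simp)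
  have key (a b : Plane) : (∂_{a} (∂_{b} f : 𝓢(Plane, ℂ)) : 𝓢(Plane, ℂ)) q
      = fderiv ℝ (fderiv ℝ f) q a b := by
    have : ((∂_{b} f : 𝓢(Plane, ℂ)) : Plane → ℂ) = fun x => fderiv ℝ f x b := by
      funext x
      exact SchwartzMap.lineDerivOp_apply_eq_fderiv b f x
    rw [SchwartzMap.lineDerivOp_apply_eq_fderiv, this,
      fderiv_clm_apply ((f.smooth 2).fderiv_right (m := 1) le_rfl |>.differentiable one_ne_zero q)
        (differentiableAt_const _)]
    simp
  exact (key _ _).trans ((hs.eq _ _).trans (key _ _).symm)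

lemma hasDerivAt_schwartz (i : Fin 2) (f : 𝓢(Plane, ℂ)) (q : Plane) :
    HasDerivAt (fun t : ℝ => f (q + t • EuclideanSpace.single i 1)) (partialDeriv i f q) 0 := by
  have : partialDeriv i f q = lineDeriv ℝ f q (EuclideanSpace.single i 1) :=
    SchwartzMap.lineDerivOp_apply _ f q
  rw [this]
  exact f.differentiableAt.lineDifferentiableAt.hasLineDerivAt

lemma hasDerivAt_add_smul_single (i j : Fin 2) (q : Plane) :
    HasDerivAt (fun t : ℝ => (q + t • EuclideanSpace.single i (1 : ℝ)) j)
      (if i = j then 1 else 0) 0 := by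
  have h (t : ℝ) : (q + t • EuclideanSpace.single i (1 : ℝ)) j
      = q j + t * (if i = j then 1 else 0) := by
    simp [eq_comm]
  simp only [h]
  simpa using ((hasDerivAt_id (0 : ℝ)).mul_const (if i = j then (1 : ℝ) else 0)).const_add (q j)

lemma partialDeriv_eq_of_mul {i : Fin 2} {f u : 𝓢(Plane, ℂ)} {h : Plane → ℂ} {h' : ℂ} {q : Plane}
    (hu : ∀ q, u q = h q * f q)
    (hh : HasDerivAt (fun t : ℝ => h (q + t • EuclideanSpace.single i 1)) h' 0) :
    partialDeriv i u q = h' * f q + h q * partialDeriv i f q := by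
  have h1 := hasDerivAt_schwartz i u q
  simp only [hu] at h1
  have h2 := hh.fun_mul (hasDerivAt_schwartz i f q)
  simp only [zero_smul, add_zero] at h2
  exact h1.unique h2

lemma partialDeriv_coordMul (i j : Fin 2) (f : 𝓢(Plane, ℂ)) :
    partialDeriv i (coordMul j f)
      = coordMul j (partialDeriv i f) + (if i = j then (1 : ℂ) else 0) • f := by
  ext q
  rw [partialDeriv_eq_of_mul (coordMul_apply j f) (hasDerivAt_add_smul_single i j q).ofReal_comp,
    add_apply, smul_apply, coordMul_apply, smul_eq_mul]
  split_ifs <;> simp [add_comm]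

lemma partialDeriv_gaussianSchwartz (i : Fin 2) (c : ℝ) (hc : 0 < c) (w v : Plane) (q : Plane) :
    partialDeriv i (gaussianSchwartz c hc w v) q
      = (-(2 * c * (q i - w i)) + Complex.I * v i) * gaussianSchwartz c hc w v q := by
  have h1 := hasDerivAt_schwartz i (gaussianSchwartz c hc w v) q
  refine h1.unique ?_
  have hj (j : Fin 2) := hasDerivAt_add_smul_single i j q
  have h2 (q : Plane) : gaussianSchwartz c hc w v q = Complex.exp
      ((-(c * ((q 0 - w 0) ^ 2 + (q 1 - w 1) ^ 2)) : ℝ)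
        + Complex.I * ((v 0 * q 0 + v 1 * q 1 : ℝ) : ℂ)) := by
    rw [gaussianSchwartz_apply, EuclideanSpace.real_norm_sq_eq, Fin.sum_univ_two,
      PiLp.inner_apply, Fin.sum_univ_two]
    simp [mul_comm]
  have h3 := ((((((hj 0).sub_const (w 0)).fun_pow 2).fun_add
    (((hj 1).sub_const (w 1)).fun_pow 2)).const_mul c).fun_neg.ofReal_comp.fun_add
    ((((hj 0).const_mul (v 0)).fun_add ((hj 1).const_mul (v 1))).ofReal_comp.const_mul
      Complex.I)).cexp
  simp only [h2]
  refine h3.congr_deriv ?_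
  simp only [zero_smul, add_zero]
  fin_cases i <;> simp <;> ring

lemma velocity_zero_apply (f : 𝓢(Plane, ℂ)) :
    velocity 0 f = (-Complex.I) • partialDeriv 0 f + (1 / 2 : ℂ) • coordMul 1 f := by
  ext q
  have : velocity 0 f q = -Complex.I * partialDeriv 0 f q - ((perp q 0 / 2 : ℝ) : ℂ) * f q :=
    velocity_apply 0 f q
  rw [this, add_apply, smul_apply, smul_apply, coordMul_apply]
  simp [perp]
  ring

lemma velocity_one_apply (f : 𝓢(Plane, ℂ)) :
    velocity 1 f = (-Complex.I) • partialDeriv 1 f - (1 / 2 : ℂ) • coordMul 0 f := by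
  ext q
  have : velocity 1 f q = -Complex.I * partialDeriv 1 f q - ((perp q 1 / 2 : ℝ) : ℂ) * f q :=
    velocity_apply 1 f q
  rw [this, sub_apply, smul_apply, smul_apply, coordMul_apply]
  simp [perp]
  ring

lemma inner_schwartzToL2 (f g : 𝓢(Plane, ℂ)) : ⟪schwartzToL2 f, schwartzToL2 g⟫_ℂ
    = ∫ q, (starRingEnd ℂ) (f q) * g q := by
  refine (SchwartzMap.inner_toL2_toL2_eq f g).trans ?_
  simp [mul_comm]

lemma inner_coordMul (i : Fin 2) (f g : 𝓢(Plane, ℂ)) :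
    ⟪schwartzToL2 (coordMul i f), schwartzToL2 g⟫_ℂ
      = ⟪schwartzToL2 f, schwartzToL2 (coordMul i g)⟫_ℂ := by
  rw [inner_schwartzToL2, inner_schwartzToL2]
  congr 1
  funext q
  simp only [coordMul_apply, map_mul, Complex.conj_ofReal]
  ring

/-- The first component of the guiding centre momentum, centred at `w`. -/
noncomputable def dualVelocityZero (w : Plane) : 𝓢(Plane, ℂ) →ₗ[ℂ] 𝓢(Plane, ℂ) :=
  (velocity 0 - coordMul 1 + ((w 1 : ℝ) : ℂ) • ContinuousLinearMap.id ℂ 𝓢(Plane, ℂ)).toLinearMap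

/-- The second component of the guiding centre momentum, centred at `w`. -/
noncomputable def dualVelocityOne (w : Plane) : 𝓢(Plane, ℂ) →ₗ[ℂ] 𝓢(Plane, ℂ) :=
  (velocity 1 + coordMul 0 - ((w 0 : ℝ) : ℂ) • ContinuousLinearMap.id ℂ 𝓢(Plane, ℂ)).toLinearMap

lemma dualVelocityZero_apply (w : Plane) (f : 𝓢(Plane, ℂ)) :
    dualVelocityZero w f = velocity 0 f - coordMul 1 f + ((w 1 : ℝ) : ℂ) • f := rfl

lemma dualVelocityOne_apply (w : Plane) (f : 𝓢(Plane, ℂ)) :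
    dualVelocityOne w f = velocity 1 f + coordMul 0 f - ((w 0 : ℝ) : ℂ) • f := rfl

lemma inner_dualVelocityZero (w : Plane) (f g : 𝓢(Plane, ℂ)) :
    ⟪schwartzToL2 (dualVelocityZero w f), schwartzToL2 g⟫_ℂ
      = ⟪schwartzToL2 f, schwartzToL2 (dualVelocityZero w g)⟫_ℂ := by
  simp only [dualVelocityZero_apply, map_add, map_sub, map_smul, inner_add_left, inner_sub_left,
    inner_add_right, inner_sub_right, inner_smul_left, inner_smul_right,
    integral_inner_velocity, inner_coordMul, Complex.conj_ofReal]

lemma inner_dualVelocityOne (w : Plane) (f g : 𝓢(Plane, ℂ)) :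
    ⟪schwartzToL2 (dualVelocityOne w f), schwartzToL2 g⟫_ℂ
      = ⟪schwartzToL2 f, schwartzToL2 (dualVelocityOne w g)⟫_ℂ := by
  simp only [dualVelocityOne_apply, map_add, map_sub, map_smul, inner_add_left, inner_sub_left,
    inner_add_right, inner_sub_right, inner_smul_left, inner_smul_right,
    integral_inner_velocity, inner_coordMul, Complex.conj_ofReal]

lemma velocity_commutator (f : 𝓢(Plane, ℂ)) :
    velocity 0 (velocity 1 f) = velocity 1 (velocity 0 f) + Complex.I • f := by
  simp only [velocity_zero_apply, velocity_one_apply, map_add, map_sub, map_smul,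
    partialDeriv_coordMul, partialDeriv_comm 1 0, coordMul_comm 1 0]
  simp only [reduceIte]
  module

lemma dualVelocity_commutator (w : Plane) (f : 𝓢(Plane, ℂ)) :
    dualVelocityZero w (dualVelocityOne w f)
      = dualVelocityOne w (dualVelocityZero w f) - Complex.I • f := by
  simp only [dualVelocityZero_apply, dualVelocityOne_apply, velocity_zero_apply,
    velocity_one_apply, map_add, map_sub, map_smul,
    partialDeriv_coordMul, partialDeriv_comm 1 0, coordMul_comm 1 0]
  simp only [reduceIte]
  module

lemma velocity_zero_dualVelocityZero (w : Plane) (f : 𝓢(Plane, ℂ)) :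
    velocity 0 (dualVelocityZero w f) = dualVelocityZero w (velocity 0 f) := by
  simp only [dualVelocityZero_apply, velocity_zero_apply,
    map_add, map_sub, map_smul, partialDeriv_coordMul]
  simp
  module

lemma velocity_one_dualVelocityOne (w : Plane) (f : 𝓢(Plane, ℂ)) :
    velocity 1 (dualVelocityOne w f) = dualVelocityOne w (velocity 1 f) := by
  simp only [dualVelocityOne_apply, velocity_one_apply,
    map_add, map_sub, map_smul, partialDeriv_coordMul]
  simp
  module

lemma velocity_zero_dualVelocityOne (w : Plane) (f : 𝓢(Plane, ℂ)) :
    velocity 0 (dualVelocityOne w f) = dualVelocityOne w (velocity 0 f) := by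
  simp only [dualVelocityOne_apply, velocity_zero_apply, velocity_one_apply,
    map_add, map_sub, map_smul, partialDeriv_coordMul, partialDeriv_comm 1 0, coordMul_comm 1 0]
  simp only [reduceIte]
  module

lemma velocity_one_dualVelocityZero (w : Plane) (f : 𝓢(Plane, ℂ)) :
    velocity 1 (dualVelocityZero w f) = dualVelocityZero w (velocity 1 f) := by
  simp only [dualVelocityZero_apply, velocity_zero_apply, velocity_one_apply,
    map_add, map_sub, map_smul, partialDeriv_coordMul, partialDeriv_comm 1 0, coordMul_comm 1 0]
  simp only [reduceIte]
  module

/-! ### The two oscillators around `w` -/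

/-- The multiplication by `gauss (· - w)` on Schwartz functions. -/
noncomputable def gaussMul (w : Plane) : 𝓢(Plane, ℂ) →L[ℂ] 𝓢(Plane, ℂ) :=
  SchwartzMap.smulLeftCLM ℂ (gaussianSchwartz (1 / 2) one_half_pos w 0)

lemma gaussMul_apply' (w : Plane) (f : 𝓢(Plane, ℂ)) (q : Plane) :
    gaussMul w f q = gaussianSchwartz (1 / 2) one_half_pos w 0 q * f q :=
  SchwartzMap.smulLeftCLM_apply_apply (SchwartzMap.hasTemperateGrowth _) f q

lemma gaussMul_apply (w : Plane) (f : 𝓢(Plane, ℂ)) (q : Plane) :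
    gaussMul w f q = (gauss (q - w) : ℂ) * f q := by
  rw [gaussMul_apply', gaussianSchwartz_apply, gauss, Complex.ofReal_exp]
  congr 2
  simp
  ring

lemma coordMul_gaussMul (i : Fin 2) (w : Plane) (f : 𝓢(Plane, ℂ)) :
    coordMul i (gaussMul w f) = gaussMul w (coordMul i f) := by
  ext q
  simp only [coordMul_apply, gaussMul_apply]
  ring

lemma partialDeriv_gaussMul (i : Fin 2) (w : Plane) (f : 𝓢(Plane, ℂ)) :
    partialDeriv i (gaussMul w f)
      = gaussMul w (partialDeriv i f - coordMul i f + ((w i : ℝ) : ℂ) • f) := by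
  ext q
  rw [partialDeriv_eq_of_mul (gaussMul_apply' w f)
    (hasDerivAt_schwartz i (gaussianSchwartz (1 / 2) one_half_pos w 0) q),
    partialDeriv_gaussianSchwartz, gaussMul_apply', add_apply, sub_apply, smul_apply,
    coordMul_apply]
  simp
  ring

/-- The lowest state of both oscillators, centred at `w`. -/
noncomputable def groundState (w : Plane) : 𝓢(Plane, ℂ) :=
  -- The phase is that of the magnetic translation from the origin to `w`. Without it, the
  -- translated Gaussian would not be annihilated by `A`, whose gauge is centred at the origin.
  gaussianSchwartz (1 / 4) (by norm_num) w (!₂[-w 1 / 2, w 0 / 2])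

lemma partialDeriv_groundState (i : Fin 2) (w : Plane) :
    partialDeriv i (groundState w) = (-(1 / 2) : ℂ) • coordMul i (groundState w)
      + ((w i : ℂ) / 2 + Complex.I * ((!₂[-w 1 / 2, w 0 / 2] : Plane) i : ℂ)) • groundState w := by
  ext q
  rw [groundState, partialDeriv_gaussianSchwartz, add_apply, smul_apply, smul_apply,
    coordMul_apply]
  simp only [smul_eq_mul]
  push_cast
  ring

/-- The Landau oscillator and the guiding centre oscillator around `w`, with the multiplication by
the Gaussian centred at `w`. -/
noncomputable def ladder (w : Plane) : GaussianLadder schwartzToL2 where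
  A := (velocity 0).toLinearMap + Complex.I • (velocity 1).toLinearMap
  A' := (velocity 0).toLinearMap - Complex.I • (velocity 1).toLinearMap
  B := dualVelocityZero w - Complex.I • dualVelocityOne w
  B' := dualVelocityZero w + Complex.I • dualVelocityOne w
  G := (gaussMul w).toLinearMap
  ground := groundState w
  A_ground := by
    change velocity 0 (groundState w) + Complex.I • velocity 1 (groundState w) = 0
    rw [velocity_zero_apply, velocity_one_apply, partialDeriv_groundState,
      partialDeriv_groundState]
    match_scalars <;> simp <;> ring_nf <;> simp
  B_ground := by
    change dualVelocityZero w (groundState w) - Complex.I • dualVelocityOne w (groundState w) = 0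
    rw [dualVelocityZero_apply, dualVelocityOne_apply, velocity_zero_apply, velocity_one_apply,
      partialDeriv_groundState, partialDeriv_groundState]
    match_scalars <;> simp <;> ring_nf <;> simp
  A_A' x := by
    change velocity 0 (velocity 0 x - Complex.I • velocity 1 x)
        + Complex.I • velocity 1 (velocity 0 x - Complex.I • velocity 1 x)
      = velocity 0 (velocity 0 x + Complex.I • velocity 1 x)
        - Complex.I • velocity 1 (velocity 0 x + Complex.I • velocity 1 x) + (2 : ℂ) • x
    simp only [map_add, map_sub, map_smul, velocity_commutator]
    match_scalars <;> ring_nf <;> simp <;> norm_num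
  B_B' x := by
    change dualVelocityZero w (dualVelocityZero w x + Complex.I • dualVelocityOne w x)
        - Complex.I • dualVelocityOne w (dualVelocityZero w x + Complex.I • dualVelocityOne w x)
      = dualVelocityZero w (dualVelocityZero w x - Complex.I • dualVelocityOne w x)
        + Complex.I • dualVelocityOne w (dualVelocityZero w x - Complex.I • dualVelocityOne w x)
        + (2 : ℂ) • x
    simp only [map_add, map_sub, map_smul, dualVelocity_commutator]
    match_scalars <;> ring_nf <;> simp <;> norm_num
  A_B' x := by
    change velocity 0 (dualVelocityZero w x + Complex.I • dualVelocityOne w x)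
        + Complex.I • velocity 1 (dualVelocityZero w x + Complex.I • dualVelocityOne w x)
      = dualVelocityZero w (velocity 0 x + Complex.I • velocity 1 x)
        + Complex.I • dualVelocityOne w (velocity 0 x + Complex.I • velocity 1 x)
    simp only [map_add, map_smul, velocity_zero_dualVelocityZero,
      velocity_zero_dualVelocityOne, velocity_one_dualVelocityZero, velocity_one_dualVelocityOne]
    module
  B_A' x := by
    change dualVelocityZero w (velocity 0 x - Complex.I • velocity 1 x)
        - Complex.I • dualVelocityOne w (velocity 0 x - Complex.I • velocity 1 x)
      = velocity 0 (dualVelocityZero w x - Complex.I • dualVelocityOne w x)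
        - Complex.I • velocity 1 (dualVelocityZero w x - Complex.I • dualVelocityOne w x)
    simp only [map_sub, map_smul, velocity_zero_dualVelocityZero,
      velocity_zero_dualVelocityOne, velocity_one_dualVelocityZero, velocity_one_dualVelocityOne]
    module
  A'_B' x := by
    change velocity 0 (dualVelocityZero w x + Complex.I • dualVelocityOne w x)
        - Complex.I • velocity 1 (dualVelocityZero w x + Complex.I • dualVelocityOne w x)
      = dualVelocityZero w (velocity 0 x - Complex.I • velocity 1 x)
        + Complex.I • dualVelocityOne w (velocity 0 x - Complex.I • velocity 1 x)
    simp only [map_add, map_sub, map_smul, velocity_zero_dualVelocityZero,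
      velocity_zero_dualVelocityOne, velocity_one_dualVelocityZero, velocity_one_dualVelocityOne]
    module
  inner_A' x y := by
    change ⟪schwartzToL2 (velocity 0 x - Complex.I • velocity 1 x), schwartzToL2 y⟫_ℂ
      = ⟪schwartzToL2 x, schwartzToL2 (velocity 0 y + Complex.I • velocity 1 y)⟫_ℂ
    simp only [map_add, map_sub, map_smul, inner_sub_left, inner_add_right, inner_smul_left,
      inner_smul_right, integral_inner_velocity, Complex.conj_I]
    ring
  inner_B' x y := by
    change ⟪schwartzToL2 (dualVelocityZero w x + Complex.I • dualVelocityOne w x),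
        schwartzToL2 y⟫_ℂ
      = ⟪schwartzToL2 x, schwartzToL2 (dualVelocityZero w y - Complex.I • dualVelocityOne w y)⟫_ℂ
    simp only [map_add, map_sub, map_smul, inner_add_left, inner_sub_right, inner_smul_left,
      inner_smul_right, inner_dualVelocityZero, inner_dualVelocityOne, Complex.conj_I]
    ring
  A_G x := by
    change velocity 0 (gaussMul w x) + Complex.I • velocity 1 (gaussMul w x)
      = gaussMul w (dualVelocityZero w x + Complex.I • dualVelocityOne w x)
    simp only [dualVelocityZero_apply, dualVelocityOne_apply, velocity_zero_apply,
      velocity_one_apply, partialDeriv_gaussMul, coordMul_gaussMul, map_add, map_sub, map_smul]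
    match_scalars <;> ring_nf <;> simp <;> ring
  B_G x := by
    change dualVelocityZero w (gaussMul w x) - Complex.I • dualVelocityOne w (gaussMul w x)
      = gaussMul w (velocity 0 x - Complex.I • velocity 1 x)
    simp only [dualVelocityZero_apply, dualVelocityOne_apply, velocity_zero_apply,
      velocity_one_apply, partialDeriv_gaussMul, coordMul_gaussMul, map_add, map_sub, map_smul]
    match_scalars <;> ring_nf <;> simp <;> ring
  G_A' x := by
    change (2 : ℂ) • gaussMul w (velocity 0 x - Complex.I • velocity 1 x)
      = (velocity 0 (gaussMul w x) - Complex.I • velocity 1 (gaussMul w x))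
        + gaussMul w (dualVelocityZero w x - Complex.I • dualVelocityOne w x)
    simp only [dualVelocityZero_apply, dualVelocityOne_apply, velocity_zero_apply,
      velocity_one_apply, partialDeriv_gaussMul, coordMul_gaussMul, map_add, map_sub, map_smul]
    match_scalars <;> ring_nf <;> simp
  G_B' x := by
    change (2 : ℂ) • gaussMul w (dualVelocityZero w x + Complex.I • dualVelocityOne w x)
      = (dualVelocityZero w (gaussMul w x) + Complex.I • dualVelocityOne w (gaussMul w x))
        + gaussMul w (velocity 0 x + Complex.I • velocity 1 x)
    simp only [dualVelocityZero_apply, dualVelocityOne_apply, velocity_zero_apply,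
      velocity_one_apply, partialDeriv_gaussMul, coordMul_gaussMul, map_add, map_sub, map_smul]
    match_scalars <;> ring_nf <;> simp <;> ring

/-- Expanding `A' A` gives the sum of the squared velocities plus `i` times their commutator; the
commutator contributes the zero-point energy `1/2`. -/
lemma hamiltonianSchwartz_eq (w : Plane) (f : 𝓢(Plane, ℂ)) :
    hamiltonianSchwartz f = (1 / 2 : ℂ) • (ladder w).A' ((ladder w).A f) + (1 / 2 : ℂ) • f := by
  change (1 / 2 : ℂ) • (∑ j : Fin 2, velocity j ∘L velocity j) f
    = (1 / 2 : ℂ) • (velocity 0 (velocity 0 f + Complex.I • velocity 1 f)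
        - Complex.I • velocity 1 (velocity 0 f + Complex.I • velocity 1 f)) + (1 / 2 : ℂ) • f
  rw [Fin.sum_univ_two]
  change (1 / 2 : ℂ) • (velocity 0 (velocity 0 f) + velocity 1 (velocity 1 f)) = _
  simp only [map_add, map_smul, velocity_commutator]
  match_scalars <;> ring_nf <;> simp <;> norm_num

lemma hamiltonianSchwartz_state (w : Plane) (n k : ℕ) :
    hamiltonianSchwartz ((ladder w).state n k) = ((n : ℂ) + 1 / 2) • (ladder w).state n k := by
  rw [hamiltonianSchwartz_eq w]
  cases n with
  | zero => rw [GaussianLadder.A_state_zero]; simp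
  | succ n =>
    rw [GaussianLadder.A_state_succ, map_smul, GaussianLadder.A'_state]
    push_cast
    module

/-! ### Completeness of the states -/

/-- An integrable function whose Fourier transform vanishes is zero almost everywhere. -/
lemma ae_eq_zero_of_forall_integral_exp_inner_eq_zero {F : Plane → ℂ} (hF : Integrable F)
    (h : ∀ ξ : Plane, ∫ q, Complex.exp (Complex.I * (⟪ξ, q⟫_ℝ : ℝ)) * F q = 0) :
    ∀ᵐ q, F q = 0 := by
  have hF0 : 𝓕 F = 0 := by
    funext ξ
    rw [Real.fourier_eq', Pi.zero_apply, ← h ((-(2 * Real.pi)) • ξ)]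
    congr 1
    funext q
    rw [smul_eq_mul, real_inner_smul_left, real_inner_comm]
    congr 2
    push_cast
    ring
  refine ae_eq_zero_of_integral_contDiff_smul_eq_zero hF.locallyIntegrable fun g hg hgc => ?_
  have hgs : HasCompactSupport (fun q => (g q : ℂ)) := hgc.comp_left Complex.ofReal_zero
  -- Every test function is the Fourier transform of a Schwartz function, so the Fourier transform
  -- can be moved onto `F`, where it vanishes.
  set ψ : 𝓢(Plane, ℂ) := hgs.toSchwartzMap (Complex.ofRealCLM.contDiff.comp hg) with hψ
  have h1 : ((𝓕 (𝓕⁻ ψ : 𝓢(Plane, ℂ)) : 𝓢(Plane, ℂ)) : Plane → ℂ) = fun q => (g q : ℂ) := by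
    rw [FourierTransform.fourier_fourierInv_eq]
    rfl
  have key := VectorFourier.integral_bilin_fourierIntegral_eq_flip (ContinuousLinearMap.mul ℂ ℂ)
    (L := innerₗ Plane) (μ := volume) (ν := volume) (f := F) (g := (𝓕⁻ ψ : 𝓢(Plane, ℂ)))
    Real.continuous_fourierChar continuous_inner hF (𝓕⁻ ψ : 𝓢(Plane, ℂ)).integrable
  rw [flip_innerₗ] at key
  have h2 : VectorFourier.fourierIntegral Real.fourierChar volume (innerₗ Plane) F = 0 := hF0
  have h3 : VectorFourier.fourierIntegral Real.fourierChar volume (innerₗ Plane)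
      (𝓕⁻ ψ : 𝓢(Plane, ℂ)) = fun q => (g q : ℂ) := h1
  rw [h2, h3] at key
  simp only [Pi.zero_apply, map_zero, zero_apply, integral_zero,
    ContinuousLinearMap.mul_apply'] at key
  rw [key]
  congr 1
  funext q
  rw [Complex.real_smul, mul_comm]

lemma hasSum_pow_mul_div_factorial (x : ℝ) (z : ℂ) :
    HasSum (fun n : ℕ => (Complex.I ^ n / n !) * (((x : ℂ) ^ n) * z))
      (Complex.exp (Complex.I * x) * z) := by
  have := (NormedSpace.expSeries_div_hasSum_exp (Complex.I * (x : ℂ))).mul_right z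
  rw [← Complex.exp_eq_exp_ℂ] at this
  refine this.congr_fun ?_
  intro n
  rw [mul_pow]
  ring

/-- If the moments of `F` vanish and `F` decays exponentially, then `F` is zero. -/
lemma ae_eq_zero_of_moments_eq_zero {F : Plane → ℂ}
    (hF : ∀ ξ : Plane, Integrable fun q => Real.exp |⟪ξ, q⟫_ℝ| * ‖F q‖)
    (hmeas : AEStronglyMeasurable F volume)
    (h : ∀ (ξ : Plane) (n : ℕ), ∫ q, ((⟪ξ, q⟫_ℝ : ℝ) : ℂ) ^ n * F q = 0) :
    ∀ᵐ q, F q = 0 := by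
  have hFi : Integrable F := by
    refine (integrable_norm_iff hmeas).1 ?_
    simpa using hF 0
  refine ae_eq_zero_of_forall_integral_exp_inner_eq_zero hFi fun ξ => ?_
  have hb (q : Plane) : HasSum (fun n : ℕ => |⟪ξ, q⟫_ℝ| ^ n / n ! * ‖F q‖)
      (Real.exp |⟪ξ, q⟫_ℝ| * ‖F q‖) := by
    have := (NormedSpace.expSeries_div_hasSum_exp |⟪ξ, q⟫_ℝ|).mul_right ‖F q‖
    rwa [← Real.exp_eq_exp_ℝ] at this
  -- The exponential series is integrated term by term; the dominating series sums to `exp |⟪ξ, q⟫|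
  -- ‖F q‖`.
  have hs := hasSum_integral_of_dominated_convergence (μ := volume)
    (F := fun (n : ℕ) (q : Plane) =>
      (Complex.I ^ n / n !) * (((⟪ξ, q⟫_ℝ : ℝ) : ℂ) ^ n * F q))
    (f := fun q => Complex.exp (Complex.I * (⟪ξ, q⟫_ℝ : ℝ)) * F q)
    (fun n q => |⟪ξ, q⟫_ℝ| ^ n / n ! * ‖F q‖)
    (fun n => by
      have : Continuous fun q : Plane => ((⟪ξ, q⟫_ℝ : ℝ) : ℂ) ^ n := by fun_prop
      exact (this.aestronglyMeasurable.mul hmeas).const_mul _)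
    (fun n => .of_forall fun q => by
      simp only [norm_mul, norm_div, norm_pow, Complex.norm_I, one_pow, Complex.norm_real,
        Complex.norm_natCast, Real.norm_eq_abs]
      apply le_of_eq
      ring)
    (.of_forall fun q => (hb q).summable)
    (by simpa only [(hb _).tsum_eq] using hF ξ)
    (.of_forall fun q => hasSum_pow_mul_div_factorial _ _)
  refine hs.unique ?_
  simp only [integral_const_mul, h, mul_zero]
  exact hasSum_zero

lemma integrable_exp_mul_conj_groundState_mul (w ξ : Plane) (f : L2) :
    Integrable fun q => Real.exp |⟪ξ, q⟫_ℝ| * ‖(starRingEnd ℂ) (groundState w q) * f q‖ := by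
  have h1 : MemLp (fun q => Real.exp |⟪ξ, q⟫_ℝ| * ‖groundState w q‖) 2 volume := by
    -- Half of the Gaussian decay absorbs the exponential: with `t = ‖q - w‖`, completing the square
    -- gives `‖ξ‖ t - t² / 8 ≤ 2 ‖ξ‖²`, with equality at `t = 4 ‖ξ‖`.
    refine MemLp.of_le_mul (c := Real.exp (‖ξ‖ * ‖w‖ + 2 * ‖ξ‖ ^ 2))
      ((gaussianSchwartz (1 / 8) (by norm_num) w 0).memLp 2 volume) ?_ (.of_forall fun q => ?_)
    · have : Continuous fun q : Plane => Real.exp |⟪ξ, q⟫_ℝ| * ‖groundState w q‖ := by fun_prop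
      exact this.aestronglyMeasurable
    · rw [norm_mul, norm_norm, Real.norm_eq_abs, Real.abs_exp, groundState,
        norm_gaussianSchwartz_apply, norm_gaussianSchwartz_apply, ← Real.exp_add, ← Real.exp_add]
      apply Real.exp_le_exp.2
      have h2 := abs_real_inner_le_norm ξ q
      have h3 : ‖q‖ ≤ ‖w‖ + ‖q - w‖ := norm_le_norm_add_norm_sub' q w
      have h4 := mul_le_mul_of_nonneg_left h3 (norm_nonneg ξ)
      nlinarith [sq_nonneg (‖q - w‖ - 4 * ‖ξ‖)]
  have h5 := h1.integrable_mul (Lp.memLp f).norm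
  refine h5.congr (.of_forall fun q => ?_)
  simp only [Pi.mul_apply, norm_mul, RCLike.norm_conj]
  ring

/-- The span of the states of `ladder w`. -/
noncomputable def stateSpan (w : Plane) : Submodule ℂ 𝓢(Plane, ℂ) :=
  Submodule.span ℂ (Set.range fun p : ℕ × ℕ => (ladder w).state p.1 p.2)

lemma state_mem_stateSpan (w : Plane) (n k : ℕ) : (ladder w).state n k ∈ stateSpan w :=
  Submodule.subset_span ⟨(n, k), rfl⟩

lemma map_mem_stateSpan {w : Plane} {T : 𝓢(Plane, ℂ) →ₗ[ℂ] 𝓢(Plane, ℂ)}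
    (hT : ∀ n k, T ((ladder w).state n k) ∈ stateSpan w) {f : 𝓢(Plane, ℂ)}
    (hf : f ∈ stateSpan w) : T f ∈ stateSpan w := by
  have : stateSpan w ≤ (stateSpan w).comap T :=
    Submodule.span_le.2 (by rintro _ ⟨⟨n, k⟩, rfl⟩; exact hT n k)
  exact this hf

lemma A_mem_stateSpan {w : Plane} {f : 𝓢(Plane, ℂ)} (hf : f ∈ stateSpan w) :
    (ladder w).A f ∈ stateSpan w := by
  refine map_mem_stateSpan (fun n k => ?_) hf
  cases n with
  | zero => rw [GaussianLadder.A_state_zero]; exact zero_mem _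
  | succ n =>
    rw [GaussianLadder.A_state_succ]
    exact Submodule.smul_mem _ _ (state_mem_stateSpan w n k)

lemma B_mem_stateSpan {w : Plane} {f : 𝓢(Plane, ℂ)} (hf : f ∈ stateSpan w) :
    (ladder w).B f ∈ stateSpan w := by
  refine map_mem_stateSpan (fun n k => ?_) hf
  cases k with
  | zero => rw [GaussianLadder.B_state_zero]; exact zero_mem _
  | succ k =>
    rw [GaussianLadder.B_state_succ]
    exact Submodule.smul_mem _ _ (state_mem_stateSpan w n k)

lemma A'_mem_stateSpan {w : Plane} {f : 𝓢(Plane, ℂ)} (hf : f ∈ stateSpan w) :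
    (ladder w).A' f ∈ stateSpan w :=
  map_mem_stateSpan (fun n k => by
    rw [GaussianLadder.A'_state]; exact state_mem_stateSpan w _ _) hf

lemma B'_mem_stateSpan {w : Plane} {f : 𝓢(Plane, ℂ)} (hf : f ∈ stateSpan w) :
    (ladder w).B' f ∈ stateSpan w :=
  map_mem_stateSpan (fun n k => by
    rw [GaussianLadder.B'_state]; exact state_mem_stateSpan w _ _) hf

/-- The velocity and the guiding centre momentum differ by a coordinate relative to `w`, so the
coordinates are combinations of ladder operators and preserve the span of the states. -/
lemma coordMul_one_eq (w : Plane) (f : 𝓢(Plane, ℂ)) : coordMul 1 f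
    = (1 / 2 : ℂ) • ((ladder w).A f + (ladder w).A' f - (ladder w).B f - (ladder w).B' f)
      + (w 1 : ℂ) • f := by
  change coordMul 1 f = (1 / 2 : ℂ) • ((velocity 0 f + Complex.I • velocity 1 f)
    + (velocity 0 f - Complex.I • velocity 1 f)
    - (dualVelocityZero w f - Complex.I • dualVelocityOne w f)
    - (dualVelocityZero w f + Complex.I • dualVelocityOne w f)) + (w 1 : ℂ) • f
  rw [dualVelocityZero_apply]
  module

lemma coordMul_zero_eq (w : Plane) (f : 𝓢(Plane, ℂ)) : coordMul 0 f
    = (-Complex.I / 2 : ℂ) • ((ladder w).B' f - (ladder w).B f - (ladder w).A f + (ladder w).A' f)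
      + (w 0 : ℂ) • f := by
  change coordMul 0 f = (-Complex.I / 2 : ℂ) •
    ((dualVelocityZero w f + Complex.I • dualVelocityOne w f)
    - (dualVelocityZero w f - Complex.I • dualVelocityOne w f)
    - (velocity 0 f + Complex.I • velocity 1 f)
    + (velocity 0 f - Complex.I • velocity 1 f)) + (w 0 : ℂ) • f
  rw [dualVelocityOne_apply]
  match_scalars <;> ring_nf <;> simp

lemma coordMul_mem_stateSpan {w : Plane} (i : Fin 2) {f : 𝓢(Plane, ℂ)} (hf : f ∈ stateSpan w) :
    coordMul i f ∈ stateSpan w := by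
  have hA := A_mem_stateSpan hf
  have hA' := A'_mem_stateSpan hf
  have hB := B_mem_stateSpan hf
  have hB' := B'_mem_stateSpan hf
  fin_cases i
  · change coordMul 0 f ∈ _
    rw [coordMul_zero_eq w]
    exact add_mem (Submodule.smul_mem _ _ (add_mem (sub_mem (sub_mem hB' hB) hA) hA'))
      (Submodule.smul_mem _ _ hf)
  · change coordMul 1 f ∈ _
    rw [coordMul_one_eq w]
    exact add_mem (Submodule.smul_mem _ _ (sub_mem (sub_mem (add_mem hA hA') hB) hB'))
      (Submodule.smul_mem _ _ hf)

lemma exists_mem_stateSpan_inner_pow (w ξ : Plane) (n : ℕ) :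
    ∃ u ∈ stateSpan w, ∀ q, u q = ((⟪ξ, q⟫_ℝ : ℝ) : ℂ) ^ n * groundState w q := by
  induction n with
  | zero => exact ⟨groundState w, state_mem_stateSpan w 0 0, fun q => by simp⟩
  | succ n ih =>
    obtain ⟨u, hu, hu'⟩ := ih
    refine ⟨(ξ 0 : ℂ) • coordMul 0 u + (ξ 1 : ℂ) • coordMul 1 u,
      add_mem (Submodule.smul_mem _ _ (coordMul_mem_stateSpan 0 hu))
        (Submodule.smul_mem _ _ (coordMul_mem_stateSpan 1 hu)), fun q => ?_⟩
    have : ⟪ξ, q⟫_ℝ = ξ 0 * q 0 + ξ 1 * q 1 := by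
      rw [PiLp.inner_apply, Fin.sum_univ_two]
      simp [mul_comm]
    rw [add_apply, smul_apply, smul_apply, coordMul_apply, coordMul_apply, hu', pow_succ, this]
    simp only [smul_eq_mul]
    push_cast
    ring

lemma groundState_ne_zero (w q : Plane) : groundState w q ≠ 0 := Complex.exp_ne_zero _

lemma schwartzToL2_groundState_ne_zero (w : Plane) : schwartzToL2 (groundState w) ≠ 0 := by
  intro h
  have : groundState w = 0 := schwartzToL2_injective (h.trans (map_zero _).symm)
  exact groundState_ne_zero w 0 (by rw [this]; rfl)

lemma inner_schwartzToL2_left (u : 𝓢(Plane, ℂ)) (f : L2) :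
    ⟪schwartzToL2 u, f⟫_ℂ = ∫ q, (starRingEnd ℂ) (u q) * f q := by
  rw [L2.inner_def]
  refine integral_congr_ae ?_
  filter_upwards [u.coeFn_toLp 2 volume] with q hq
  change ⟪(u.toLp 2 volume) q, f q⟫_ℂ = _
  rw [hq, RCLike.inner_apply, mul_comm]

/-- The span of the states contains every polynomial times the ground state. A vector `f` orthogonal
to it makes all moments of `conj (groundState w) * f` vanish; this product decays fast enough to be
determined by its moments, and the ground state has no zeros. -/
lemma orthogonal_span_basisVec (w : Plane) :
    (Submodule.span ℂ (Set.range (ladder w).basisVec))ᗮ = ⊥ := by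
  rw [Submodule.eq_bot_iff]
  intro f hf
  have h0 := schwartzToL2_groundState_ne_zero w
  have hspan (u : 𝓢(Plane, ℂ)) (hu : u ∈ stateSpan w) : ⟪schwartzToL2 u, f⟫_ℂ = 0 := by
    induction hu using Submodule.span_induction with
    | mem u hu =>
      obtain ⟨p, rfl⟩ := hu
      have h1 : ⟪(ladder w).basisVec p, f⟫_ℂ = 0 :=
        hf _ (Submodule.subset_span ⟨p, rfl⟩)
      rw [GaussianLadder.basisVec, inner_smul_left, mul_eq_zero] at h1
      refine h1.resolve_left ?_
      have := (ladder w).norm_state_ne_zero h0 p.1 p.2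
      simpa using this
    | zero => simp
    | add u v _ _ hu hv => rw [map_add, inner_add_left, hu, hv, add_zero]
    | smul c u _ hu => rw [map_smul, inner_smul_left, hu, mul_zero]
  have hae : ∀ᵐ q, (starRingEnd ℂ) (groundState w q) * f q = 0 := by
    refine ae_eq_zero_of_moments_eq_zero
      (fun ξ => integrable_exp_mul_conj_groundState_mul w ξ f) ?_ fun ξ n => ?_
    · have : Continuous fun q => (starRingEnd ℂ) (groundState w q) :=
        Complex.continuous_conj.comp (groundState w).continuous
      exact this.aestronglyMeasurable.mul (Lp.aestronglyMeasurable f)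
    · obtain ⟨u, hu, hu'⟩ := exists_mem_stateSpan_inner_pow w ξ n
      rw [← hspan u hu, inner_schwartzToL2_left]
      congr 1
      funext q
      rw [hu', map_mul, map_pow, Complex.conj_ofReal, mul_assoc]
  rw [Lp.eq_zero_iff_ae_eq_zero]
  filter_upwards [hae] with q hq
  exact (mul_eq_zero.1 hq).resolve_left (by simpa using groundState_ne_zero w q)

/-- The Hilbert basis of `L²(ℝ²)` of joint eigenfunctions of both oscillators. -/
noncomputable def landauBasis (w : Plane) : HilbertBasis (ℕ × ℕ) ℂ L2 :=
  HilbertBasis.mkOfOrthogonalEqBot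
    ((ladder w).orthonormal_basisVec (schwartzToL2_groundState_ne_zero w))
    (orthogonal_span_basisVec w)

lemma landauBasis_apply (w : Plane) (p : ℕ × ℕ) : landauBasis w p = (ladder w).basisVec p := by
  rw [landauBasis, HilbertBasis.coe_mkOfOrthogonalEqBot]

end Landau

/-! ### Norm of a block with one entry per row and column -/

namespace HilbertBasis

variable {H : Type*} [NormedAddCommGroup H] [InnerProductSpace ℂ H]

/-- If the block of a bounded operator from level `m` to level `n` of a Hilbert basis has at most
one nonzero entry in each row and column, namely where `m + k = l + n`, then the block is bounded by
the supremum of its entries. -/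
lemma norm_inner_map_le_of_entries (b : HilbertBasis (ℕ × ℕ) ℂ H) (T : H →L[ℂ] H) {n m : ℕ}
    {C : ℝ} (hC : 0 ≤ C) (hT0 : ∀ k l, m + k ≠ l + n → ⟪b (n, k), T (b (m, l))⟫_ℂ = 0)
    (hTC : ∀ k l, ‖⟪b (n, k), T (b (m, l))⟫_ℂ‖ ≤ C) {x y : H}
    (hx : ∀ j k, j ≠ n → ⟪b (j, k), x⟫_ℂ = 0) (hy : ∀ j k, j ≠ m → ⟪b (j, k), y⟫_ℂ = 0) :
    ‖⟪x, T y⟫_ℂ‖ ≤ C * ‖x‖ * ‖y‖ := by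
  classical
  have hsum : HasSum (fun p => ⟪x, T (b p)⟫_ℂ * ⟪b p, y⟫_ℂ) ⟪x, T y⟫_ℂ := by
    convert! (b.hasSum_repr y).mapL (innerSL ℂ x ∘L T) using 1
    ext p
    rw [ContinuousLinearMap.comp_apply, map_smul, innerSL_apply_apply, b.repr_apply_apply,
      inner_smul_right, mul_comm]
  -- Column `l` meets only the row `k = l + n - m`. The condition `m ≤ l + n` guards the truncated
  -- subtraction: when it fails, the column is zero.
  have hcol (l : ℕ) : ‖⟪x, T (b (m, l))⟫_ℂ‖
      ≤ C * (if m ≤ l + n then ‖⟪b (n, l + n - m), x⟫_ℂ‖ else 0) := by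
    have h1 (p : ℕ × ℕ) (hp : p ≠ (n, l + n - m)) :
        ⟪x, b p⟫_ℂ * ⟪b p, T (b (m, l))⟫_ℂ = 0 := by
      obtain ⟨j, k⟩ := p
      by_cases hj : j = n
      · subst hj
        rw [hT0 k l, mul_zero]
        rintro h
        apply hp
        rw [Prod.mk.injEq]
        exact ⟨rfl, by omega⟩
      · rw [← inner_conj_symm, hx j k hj, map_zero, zero_mul]
    rw [← b.tsum_inner_mul_inner, tsum_eq_single _ h1, norm_mul, mul_comm, norm_inner_symm x]
    split_ifs with hml
    · gcongr
      exact hTC _ _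
    · rw [hT0 _ _ (by omega)]
      simp
  refine le_of_tendsto hsum.norm (.of_forall fun s => ?_)
  set s' := s.filter (fun p => p.1 = m ∧ m ≤ p.2 + n)
  set e : ℕ × ℕ → ℕ × ℕ := fun p => (n, p.2 + n - m)
  -- Distinct columns meet distinct rows. After Cauchy–Schwarz, this is what lets Bessel's
  -- inequality bound the sum over the coefficients of `x` as well.
  have he : Set.InjOn e s' := by
    rintro ⟨j, k⟩ h ⟨j', k'⟩ h' heq
    simp only [s', Finset.coe_filter, Set.mem_ofPred_eq] at h h'
    simp only [e, Prod.mk.injEq, true_and] at heq ⊢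
    omega
  have hsub : ∑ p ∈ s, ⟪x, T (b p)⟫_ℂ * ⟪b p, y⟫_ℂ
      = ∑ p ∈ s', ⟪x, T (b p)⟫_ℂ * ⟪b p, y⟫_ℂ := by
    refine (Finset.sum_filter_of_ne ?_).symm
    rintro ⟨j, l⟩ _ hne
    by_cases hj : j = m
    · subst hj
      refine ⟨rfl, ?_⟩
      by_contra hlt
      apply hne
      have := hcol l
      rw [if_neg hlt, mul_zero, norm_le_zero_iff] at this
      rw [this, zero_mul]
    · rw [hy j l hj, mul_zero] at hne
      exact absurd rfl hne
  calc ‖∑ p ∈ s, ⟪x, T (b p)⟫_ℂ * ⟪b p, y⟫_ℂ‖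
      ≤ ∑ p ∈ s', ‖⟪x, T (b p)⟫_ℂ * ⟪b p, y⟫_ℂ‖ := by
        rw [hsub]; exact norm_sum_le _ _
    _ ≤ ∑ p ∈ s', C * (‖⟪b (e p), x⟫_ℂ‖ * ‖⟪b p, y⟫_ℂ‖) := by
        refine Finset.sum_le_sum ?_
        rintro ⟨j, l⟩ hp
        obtain ⟨-, rfl, hml⟩ := Finset.mem_filter.1 hp
        have := hcol l
        rw [if_pos hml] at this
        rw [norm_mul, ← mul_assoc]
        gcongr
    _ = C * ∑ p ∈ s', ‖⟪b (e p), x⟫_ℂ‖ * ‖⟪b p, y⟫_ℂ‖ := by rw [Finset.mul_sum]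
    _ ≤ C * (√(∑ p ∈ s', ‖⟪b (e p), x⟫_ℂ‖ ^ 2) * √(∑ p ∈ s', ‖⟪b p, y⟫_ℂ‖ ^ 2)) := by
        gcongr
        exact Real.sum_mul_le_sqrt_mul_sqrt _ _ _
    _ ≤ C * (‖x‖ * ‖y‖) := by
        gcongr
        · refine Real.sqrt_le_iff.2 ⟨norm_nonneg _, ?_⟩
          rw [← Finset.sum_image (f := fun p => ‖⟪b p, x⟫_ℂ‖ ^ 2) he]
          exact b.orthonormal.sum_inner_products_le x
        · exact Real.sqrt_le_iff.2 ⟨norm_nonneg _, b.orthonormal.sum_inner_products_le y⟩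
    _ = _ := by ring

end HilbertBasis

/-! ### Landau levels in the basis, and averaging over the centre -/

namespace Landau

/-- The adjoint is closed and extends the symmetric core, hence extends its closure. Eigenvectors,
which need not be Schwartz, can thus be tested against Schwartz functions. -/
lemma hamiltonian_le_adjoint : hamiltonian ≤ hamiltonianCore.adjoint := by
  refine LinearPMap.le_of_le_graph ?_
  rw [hamiltonian, ← hamiltonianCore_isClosable.graph_closure_eq_closure_graph]
  exact Submodule.topologicalClosure_minimal _
    (LinearPMap.le_graph_of_le (hamiltonianCore_symmetric.le_adjoint hamiltonianCore_dense))
    (LinearPMap.adjoint_isClosed hamiltonianCore_dense)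

lemma inner_hamiltonianSchwartz_of_mem_level {n : ℕ} {ψ : L2} (hψ : ψ ∈ level n)
    (f : 𝓢(Plane, ℂ)) : ⟪schwartzToL2 (hamiltonianSchwartz f), ψ⟫_ℂ
      = ((n : ℂ) + 1 / 2) * ⟪schwartzToL2 f, ψ⟫_ℂ := by
  obtain ⟨hd, hψ⟩ := hψ
  have h1 : hamiltonianCore.adjoint ⟨ψ, hamiltonian_le_adjoint.1 hd⟩
      = ((n : ℂ) + 1 / 2) • ψ :=
    (hamiltonian_le_adjoint.2 (x := ⟨ψ, hd⟩) (y := ⟨ψ, hamiltonian_le_adjoint.1 hd⟩) rfl).symm.trans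
      hψ
  have h2 := LinearPMap.adjoint_isFormalAdjoint hamiltonianCore_dense
    ⟨ψ, hamiltonian_le_adjoint.1 hd⟩ ⟨schwartzToL2 f, schwartzToL2_mem_domain f⟩
  rw [h1, hamiltonianCore_apply] at h2
  rw [← inner_conj_symm, ← h2, inner_conj_symm, inner_smul_right]

/-- Eigenvectors of a symmetric operator for the distinct eigenvalues `j + 1/2` and `n + 1/2` are
orthogonal. Only this inclusion is needed, not that the basis vectors `(n, k)` span the level. -/
lemma inner_landauBasis_eq_zero_of_mem_level {n : ℕ} {ψ : L2} (hψ : ψ ∈ level n) (w : Plane)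
    (j k : ℕ) (hj : j ≠ n) : ⟪landauBasis w (j, k), ψ⟫_ℂ = 0 := by
  have h := inner_hamiltonianSchwartz_of_mem_level hψ ((ladder w).state j k)
  rw [hamiltonianSchwartz_state, map_smul, inner_smul_left] at h
  have h0 : ⟪schwartzToL2 ((ladder w).state j k), ψ⟫_ℂ = 0 := by
    have h1 : (starRingEnd ℂ) ((j : ℂ) + 1 / 2) = (j : ℂ) + 1 / 2 := by simp [map_ofNat]
    rw [h1] at h
    have h2 : ((j : ℂ) - n) * ⟪schwartzToL2 ((ladder w).state j k), ψ⟫_ℂ = 0 := by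
      linear_combination h
    exact (mul_eq_zero.1 h2).resolve_left (sub_ne_zero.2 (by exact_mod_cast hj))
  rw [landauBasis_apply, GaussianLadder.basisVec, inner_smul_left, h0, mul_zero]

lemma norm_gauss_sub_le (w q : Plane) : ‖(gauss (q - w) : ℂ)‖ ≤ 1 := by
  rw [Complex.norm_real]
  exact norm_gauss_le _

lemma memLp_top_gauss_sub (w : Plane) :
    MemLp (fun q => (gauss (q - w) : ℂ)) ∞ (volume : Measure Plane) :=
  memLp_top_of_bound (Complex.continuous_ofReal.comp
    (continuous_gauss.comp (continuous_id.sub continuous_const))).aestronglyMeasurable 1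
    (.of_forall fun q => norm_gauss_sub_le w q)

/-- The multiplication by `gauss (· - w)` on `L²(ℝ²)`. -/
noncomputable def gaussOp (w : Plane) : L2 →L[ℂ] L2 := mulOp _ (memLp_top_gauss_sub w)

lemma norm_gaussOp_le (w : Plane) : ‖gaussOp w‖ ≤ 1 := by
  refine ContinuousLinearMap.opNorm_le_bound _ zero_le_one fun f => ?_
  rw [one_mul]
  refine Lp.norm_le_norm_of_ae_le ?_
  filter_upwards [mulOp_apply _ (memLp_top_gauss_sub w) f] with q hq
  rw [gaussOp, hq, norm_mul]
  exact mul_le_of_le_one_left (norm_nonneg _) (norm_gauss_sub_le w q)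

lemma gaussOp_schwartzToL2 (w : Plane) (f : 𝓢(Plane, ℂ)) :
    gaussOp w (schwartzToL2 f) = schwartzToL2 ((ladder w).G f) := by
  refine Lp.ext ?_
  filter_upwards [mulOp_apply _ (memLp_top_gauss_sub w) (schwartzToL2 f),
    f.coeFn_toLp 2 volume, (gaussMul w f).coeFn_toLp 2 volume] with q h1 h2 h3
  change gaussOp w (schwartzToL2 f) q = ((gaussMul w f).toLp 2 volume) q
  have h4 : schwartzToL2 f q = f q := h2
  rw [gaussOp, h1, h3, h4, gaussMul_apply]

lemma bracket_pos (a : ℝ) : 0 < bracket a := lt_of_lt_of_le one_pos (le_max_left _ _)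

/-- The bound does not depend on `w`, although the basis used to prove it does: the levels
themselves are independent of the centre. -/
lemma norm_inner_gaussOp_le {n m : ℕ} {x y : L2} (hx : x ∈ level n) (hy : y ∈ level m)
    (w : Plane) :
    ‖⟪x, gaussOp w y⟫_ℂ‖ ≤ 2 / bracket ((n : ℝ) - m) * ‖x‖ * ‖y‖ := by
  refine (landauBasis w).norm_inner_map_le_of_entries (gaussOp w)
    (div_nonneg zero_le_two (bracket_pos _).le) (fun k l h => ?_) (fun k l => ?_)
    (inner_landauBasis_eq_zero_of_mem_level hx w) (inner_landauBasis_eq_zero_of_mem_level hy w)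
  · rw [landauBasis_apply, landauBasis_apply]
    exact (ladder w).inner_basisVec_of_ne n k m l _ (gaussOp_schwartzToL2 w) h
  · rw [landauBasis_apply, landauBasis_apply]
    exact (ladder w).norm_inner_basisVec_le (schwartzToL2_groundState_ne_zero w) n k m l _
      (gaussOp_schwartzToL2 w) (norm_gaussOp_le w)

lemma inner_mulOp (V : Plane → ℂ) (hV : MemLp V ∞ (volume : Measure Plane)) (x y : L2) :
    ⟪x, mulOp V hV y⟫_ℂ = ∫ q, V q * ((starRingEnd ℂ) (x q) * y q) := by
  rw [L2.inner_def]
  refine integral_congr_ae ?_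
  filter_upwards [mulOp_apply V hV y] with q hq
  rw [hq, RCLike.inner_apply]
  ring

lemma integrable_conj_mul (x y : L2) : Integrable fun q => (starRingEnd ℂ) (x q) * y q := by
  refine (L2.integrable_inner (𝕜 := ℂ) x y).congr (.of_forall fun q => ?_)
  simp only [RCLike.inner_apply]
  ring

lemma integrable_gauss_sub (ν : Measure Plane) [IsFiniteMeasure ν] (q : Plane) :
    Integrable (fun w => gauss (q - w)) ν :=
  .of_bound (continuous_gauss.comp (continuous_const.sub continuous_id)).aestronglyMeasurable 1
    (.of_forall fun _ => norm_gauss_le _)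

/-- Convolving the Gaussian with a positive finite measure averages its translates. -/
lemma integral_gauss_mul_eq (ν : Measure Plane) [IsFiniteMeasure ν] (x y : L2) :
    Integrable (fun q => ((∫ w, gauss (q - w) ∂ν : ℝ) : ℂ) * ((starRingEnd ℂ) (x q) * y q)) ∧
    ∫ q, ((∫ w, gauss (q - w) ∂ν : ℝ) : ℂ) * ((starRingEnd ℂ) (x q) * y q)
      = ∫ w, ⟪x, gaussOp w y⟫_ℂ ∂ν := by
  -- Fubini applies because `conj x * y` is integrable in `q` and constant in `w`, the measure `ν`
  -- is finite, and the Gaussian is bounded by one.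
  have hint : Integrable (fun p : Plane × Plane =>
      (gauss (p.1 - p.2) : ℂ) * ((starRingEnd ℂ) (x p.1) * y p.1)) (volume.prod ν) := by
    refine ((integrable_conj_mul x y).comp_fst ν).bdd_mul (c := 1) ?_ (.of_forall fun p => ?_)
    · exact (Complex.continuous_ofReal.comp
        (continuous_gauss.comp (continuous_fst.sub continuous_snd))).aestronglyMeasurable
    · exact norm_gauss_sub_le _ _
  have hq (q : Plane) : ∫ w, (gauss (q - w) : ℂ) * ((starRingEnd ℂ) (x q) * y q) ∂ν
      = ((∫ w, gauss (q - w) ∂ν : ℝ) : ℂ) * ((starRingEnd ℂ) (x q) * y q) := by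
    rw [integral_mul_const, integral_complex_ofReal]
  constructor
  · have := hint.integral_prod_left
    simpa only [hq] using this
  · simp only [← hq, gaussOp, inner_mulOp]
    exact integral_integral_swap hint

lemma gaussConv_eq (μ : SignedMeasure Plane) (q : Plane) :
    gaussConv μ q = ∫ w, gauss (q - w) ∂μ.toJordanDecomposition.posPart
      - ∫ w, gauss (q - w) ∂μ.toJordanDecomposition.negPart := by
  have hflip : (ContinuousLinearMap.lsmul ℝ ℝ : ℝ →L[ℝ] ℝ →L[ℝ] ℝ)
      = (ContinuousLinearMap.lsmul ℝ ℝ).flip := by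
    ext
    simp
  have hint (ν : Measure Plane) [IsFiniteMeasure ν] :
      ν.toSignedMeasure.Integrable (fun w => gauss (q - w)) := by
    rw [VectorMeasure.Integrable, Measure.variation_toSignedMeasure]
    exact integrable_gauss_sub ν q
  unfold gaussConv
  conv_lhs => rw [← μ.toSignedMeasure_toJordanDecomposition]
  rw [JordanDecomposition.toSignedMeasure,
    VectorMeasure.integral_sub_vectorMeasure (hint _) (hint _), hflip,
    VectorMeasure.integral_toSignedMeasure, VectorMeasure.integral_toSignedMeasure]

lemma norm_integral_inner_gaussOp_le (ν : Measure Plane) [IsFiniteMeasure ν] {n m : ℕ} {x y : L2}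
    (hx : x ∈ level n) (hy : y ∈ level m) :
    ‖∫ w, ⟪x, gaussOp w y⟫_ℂ ∂ν‖ ≤ 2 / bracket ((n : ℝ) - m) * ‖x‖ * ‖y‖ * ν.real Set.univ :=
  norm_integral_le_of_norm_le_const (.of_forall (norm_inner_gaussOp_le hx hy))

lemma norm_inner_mulOp_gaussConv_le (μ : SignedMeasure Plane)
    (hV : MemLp (fun q => (gaussConv μ q : ℂ)) ∞ (volume : Measure Plane)) {n m : ℕ} {x y : L2}
    (hx : x ∈ level n) (hy : y ∈ level m) :
    ‖⟪x, mulOp _ hV y⟫_ℂ‖ ≤ 2 / bracket ((n : ℝ) - m)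
      * (μ.toJordanDecomposition.posPart.real Set.univ
        + μ.toJordanDecomposition.negPart.real Set.univ) * ‖x‖ * ‖y‖ := by
  obtain ⟨hi, he⟩ := integral_gauss_mul_eq μ.toJordanDecomposition.posPart x y
  obtain ⟨hi', he'⟩ := integral_gauss_mul_eq μ.toJordanDecomposition.negPart x y
  rw [inner_mulOp]
  simp only [gaussConv_eq, Complex.ofReal_sub, sub_mul]
  rw [integral_sub hi hi', he, he']
  refine (norm_sub_le _ _).trans ((add_le_add (norm_integral_inner_gaussOp_le _ hx hy)
    (norm_integral_inner_gaussOp_le _ hx hy)).trans_eq ?_)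
  ring

end Landau

/-! ### The operator norm bound -/

theorem mainTheorem4 (V : Landau.Plane → ℝ) (hV : V ∈ Landau.gaussClass) :
    ∃ d : ℝ, 0 < d ∧ ∀ n m : ℕ,
      ‖Landau.levelProj n ∘L
          Landau.mulOp (fun q => (V q : ℂ)) (Landau.memLp_top_of_mem_gaussClass hV) ∘L
          Landau.levelProj m‖
        ≤ d / Landau.bracket ((n : ℝ) - (m : ℝ)) := by
  obtain ⟨μ, rfl⟩ := id hV
  set M : ℝ := μ.toJordanDecomposition.posPart.real Set.univ
    + μ.toJordanDecomposition.negPart.real Set.univ with hM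
  have hM0 : 0 ≤ M := add_nonneg measureReal_nonneg measureReal_nonneg
  -- The summand `1` only secures `d > 0` when `μ = 0`.
  refine ⟨2 * M + 1, by positivity, fun n m => ?_⟩
  have hb := Landau.bracket_pos ((n : ℝ) - m)
  refine ContinuousLinearMap.opNorm_le_bound _ (by positivity) fun f => ?_
  set y := Landau.levelProj m f with hy
  set T := Landau.mulOp (fun q => (Landau.gaussConv μ q : ℂ))
    (Landau.memLp_top_of_mem_gaussClass hV)
  set x := Landau.levelProj n (T y) with hx
  change ‖x‖ ≤ _
  have hxn : x ∈ Landau.level n := Submodule.starProjection_apply_mem _ _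
  have hym : y ∈ Landau.level m := Submodule.starProjection_apply_mem _ _
  have hyf : ‖y‖ ≤ ‖f‖ := Submodule.norm_starProjection_apply_le _ f
  -- Since `x` is the projection of `T y`, pairing it with `T y` gives `‖x‖²`. The form bound on the
  -- levels then becomes a norm bound after division by `‖x‖`.
  have hxx : ⟪x, T y⟫_ℂ = ⟪x, x⟫_ℂ := by
    conv_rhs => rw [hx, Landau.levelProj, ← Submodule.inner_starProjection_left_eq_right,
      Submodule.starProjection_eq_self_iff.2 (Submodule.starProjection_apply_mem _ _)]
    rfl
  have key := Landau.norm_inner_mulOp_gaussConv_le μ (Landau.memLp_top_of_mem_gaussClass hV) hxn hym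
  change ‖⟪x, T y⟫_ℂ‖ ≤ _ at key
  rw [hxx, inner_self_eq_norm_sq_to_K] at key
  have key' : ‖x‖ * ‖x‖ ≤ ‖x‖ * ((2 * M + 1) / Landau.bracket ((n : ℝ) - m) * ‖f‖) := by
    calc ‖x‖ * ‖x‖ = ‖((‖x‖ : ℂ)) ^ 2‖ := by simp [pow_two]
      _ ≤ 2 / Landau.bracket ((n : ℝ) - m) * M * ‖x‖ * ‖y‖ := key
      _ = ‖x‖ * ((2 * M) / Landau.bracket ((n : ℝ) - m) * ‖y‖) := by ring
      _ ≤ _ := by gcongr; linarith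
  rcases (norm_nonneg x).eq_or_lt with h | h
  · rw [← h]; positivity
  · exact le_of_mul_le_mul_left key' h
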